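/- **Setting.** Let $m,u\ge 1$ be integers, $n=m+u$, $\mathcal X\subseteq\mathbb R^d$, $\mathcal Y\subseteq\mathbb R$, and let $(x_i,y_i)_{i=1}^n$ be a full sample in $\mathcal X\times\mathcal Y$. For a function $h$ on $\mathcal X\times\mathcal Y$ write $h(i)=h(x_i,y_i)$, $\mathcal L_n(h)=\frac1n\sum_{i=1}^n h(i)$ and $T_n(h)=\frac1n\sum_{i=1}^n h(i)^2$. Let $\mathbf d=(d_1,\dots,d_u)$ have independent entries, $d_i$ uniform on $\{i,\dots,n\}$, and let $\mathbf Z_{\mathbf d}$ be the vector of $u$ indices obtained as follows: start with the array $I=(1,\dots,n)$ and, for $i=1,\dots,u$, put $\mathbf Z_{\mathbf d}(i)=I(d_i)$ and then swap the values $I(i)$ and $I(d_i)$. (So $\{\mathbf Z_{\mathbf d}\}$ is drawn uniformly without replacement from $[n]$.) The set $\{\mathbf Z_{\mathbf d}\}$ is the test index set and its complement $\overline{\mathbf Z_{\mathbf d}}$ the training index set. Put $\mathcal U_h(\mathbf d)=\frac1u\sum_{i\in\{\mathbf Z_{\mathbf d}\}}h(i)$, $\mathcal L^{(m)}_h(\mathbf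 d)=\frac1m\sum_{i\in\overline{\mathbf Z_{\mathbf d}}}h(i)$, $R^+_{u,\mathbf d}h=\mathcal U_h(\mathbf d)-\mathcal L_n(h)$, $R^+_{m,\mathbf d}h=\mathcal L^{(m)}_h(\mathbf d)-\mathcal L_n(h)$, $R^-_{u,\mathbf d}=-R^+_{u,\mathbf d}$ and $R^-_{m,\mathbf d}=-R^+_{m,\mathbf d}$. The operator $R^+_{\min\{u,m\},\mathbf d}$ is $R^+_{u,\mathbf d}$ if $u\le m$ and $R^+_{m,\mathbf d}$ otherwise. Let $\mathcal F$ be a class of functions $f:\mathcal X\to\mathbb R$, $\ell$ a loss, $\ell_f(x,y)=\ell(f(x),y)$, and suppose that $0\le\ell_f(i)\le L_0$ for all $f\in\mathcal F$ and $i\in[n]$, where $L_0\ge2\sqrt2$. For each $\mathbf d$ let $\hat f_{\mathbf d,u}\in\operatorname{argmin}_{f\in\mathcal F}\mathcal U_{\ell_f}(\mathbf d)$ (the test oracle) and $\hat f_{\mathbf d,m}\in\operatorname{argmin}_{f\in\mathcal F}\mathcal L^{(m)}_{\ell_f}(\mathbf d)$ (the empirical minimizer). A function $\psi:[0,\infty)\to[0,\infty)$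 is sub-root if it is nondecreasing and $r\mapsto\psi(r)/\sqrt r$ is nonincreasing on $(0,\infty)$. Its fixed point is the largest $r\ge0$ with $\psi(r)=r$, that is, the unique positive fixed point if $\psi\not\equiv0$, and $0$ if $\psi\equiv0$. **Main Assumption.** (1) There is $f^*_n\in\mathcal F$ with $\mathcal L_n(\ell_{f^*_n})=\inf_{f\in\mathcal F}\mathcal L_n(\ell_f)$. (2) There is a constant $B$ such that $T_n(h)\le B\,\mathcal L_n(h)$ for every $h\in\Delta^*_{\mathcal F}:=\{\ell_f-\ell_{f^*_n}:f\in\mathcal F\}$. **Theorem.** For all $B$ and $L_0\ge2\sqrt2$ there is a constant $c_2>0$, depending only on $B$ and $L_0$, such that the following holds in every setting as above that satisfies the Main Assumption with the constant $B$. Let $\psi_{u,m}$ be a sub-root function with fixed point $r^*$ such that for all $r\ge r^*$ $$\psi_{u,m}(r)\ge\max\Big\{\mathbb E\sup_{h\in\Delta^*_{\mathcal F},\,B\mathcal L_n(h)\le r}R^-_{u,\mathbf d}h,\ \ \mathbb E\sup_{h\in\Delta^*_{\mathcal F},\,B\mathcal L_n(h)\le r}R^-_{m,\mathbf d}h,\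 \ \mathbb E\sup_{h\in\Delta^*_{\mathcal F},\,B\mathcal L_n(h)\le r}R^+_{\min\{u,m\},\mathbf d}h^2\Big\}.$$ Then for every $x>0$, with probability at least $1-e^{-x}$ over $\mathbf d$, both $$\mathcal L_n(\ell_{\hat f_{\mathbf d,u}}-\ell_{f^*_n})\le c_2\Big(r^*+\frac xu\Big)\quad\text{and}\quad\mathcal L_n(\ell_{\hat f_{\mathbf d,m}}-\ell_{f^*_n})\le c_2\Big(r^*+\frac xm\Big).$$ -/

import Mathlib

open MeasureTheory

namespace Transductive

/-! ### Sampling without replacement -/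

/-- Range of the `i`-th draw, `{i, …, n}` in one-based numbering, for `n = m + u`
(indices are zero-based here). -/
abbrev DrawRange (m u : ℕ) (i : Fin u) : Type :=
  {j : Fin (m + u) // (i : ℕ) ≤ (j : ℕ)}

instance instNonemptyDrawRange (m u : ℕ) (i : Fin u) : Nonempty (DrawRange m u i) :=
  ⟨⟨Fin.natAdd m i, by simp⟩⟩

/-- A vector of draws `d = (d_1, …, d_u)`, with `d_i` in `{i, …, n}`. -/
abbrev Draws (m u : ℕ) : Type := (i : Fin u) → DrawRange m u i

/-- The law of `d`: independent coordinates, the `i`-th one uniform on `{i, …, n}`. -/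
noncomputable def drawLaw (m u : ℕ) : Measure (Draws m u) :=
  Measure.pi fun i => (PMF.uniformOfFintype (DrawRange m u i)).toMeasure

/-- The array `I` of the algorithm RANDPERM after its first `k` steps: it starts as the identity
on `[n]`, and step `i` swaps the values stored at the positions `i` and `d_i`. -/
def permArray {m u : ℕ} (d : Draws m u) : ℕ → Equiv.Perm (Fin (m + u))
  | 0 => 1
  | k + 1 =>
    if hk : k < u then
      permArray d k * Equiv.swap ⟨k, by omega⟩ (d ⟨k, hk⟩).1
    else permArray d k

/-- The output `Z_d` of RANDPERM: step `i` outputs the value stored at position `d_i`,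
before the swap of that step. -/
def Z {m u : ℕ} (d : Draws m u) (i : Fin u) : Fin (m + u) :=
  permArray d i (d i).1

/-- The set of test indices `{Z_d}`. -/
def testSet {m u : ℕ} (d : Draws m u) : Finset (Fin (m + u)) :=
  Finset.univ.image (Z d)

/-- The set of training indices, the complement of `{Z_d}`. -/
def trainSet {m u : ℕ} (d : Draws m u) : Finset (Fin (m + u)) :=
  (testSet d)ᶜ

/-! ### Losses and empirical averages

`S i` is the labelled point `(x_i, y_i)` of the full sample, and `h (S i)` is `h(i)`. -/

section Functionals

variable {α β : Type*} {m u : ℕ}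

/-- The function `ℓ_f (x, y) = ℓ (f x, y)`. -/
def lossFun (ℓ : ℝ → β → ℝ) (f : α → ℝ) : α × β → ℝ :=
  fun p => ℓ (f p.1) p.2

/-- The full-sample average `L_n(h)`, with `n = m + u`. -/
noncomputable def fullAvg (S : Fin (m + u) → α × β) (h : α × β → ℝ) : ℝ :=
  (1 / ((m + u : ℕ) : ℝ)) * ∑ i, h (S i)

/-- The average square `T_n(h) = L_n(h²)`. -/
noncomputable def fullSqAvg (S : Fin (m + u) → α × β) (h : α × β → ℝ) : ℝ :=
  (1 / ((m + u : ℕ) : ℝ)) * ∑ i, h (S i) ^ 2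

/-- The test average `U_h^{(u)}(Z_d)`. -/
noncomputable def testAvg (S : Fin (m + u) → α × β) (d : Draws m u) (h : α × β → ℝ) : ℝ :=
  (1 / (u : ℝ)) * ∑ i ∈ testSet d, h (S i)

/-- The training average `L_h^{(m)}` over the complement of `{Z_d}`. -/
noncomputable def trainAvg (S : Fin (m + u) → α × β) (d : Draws m u) (h : α × β → ℝ) : ℝ :=
  (1 / (m : ℝ)) * ∑ i ∈ trainSet d, h (S i)

/-- `R⁺_{u,d} h`. -/
noncomputable def Rplus_u (S : Fin (m + u) → α × β) (d : Draws m u) (h : α × β → ℝ) : ℝ :=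
  testAvg S d h - fullAvg S h

/-- `R⁺_{m,d} h`. -/
noncomputable def Rplus_m (S : Fin (m + u) → α × β) (d : Draws m u) (h : α × β → ℝ) : ℝ :=
  trainAvg S d h - fullAvg S h

/-- `R⁻_{u,d} h`. -/
noncomputable def Rminus_u (S : Fin (m + u) → α × β) (d : Draws m u) (h : α × β → ℝ) : ℝ :=
  -Rplus_u S d h

/-- `R⁻_{m,d} h`. -/
noncomputable def Rminus_m (S : Fin (m + u) → α × β) (d : Draws m u) (h : α × β → ℝ) : ℝ :=
  -Rplus_m S d h

/-- `R⁺_{min(u,m),d} h`. For `u = m` the two candidates have the same law. -/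
noncomputable def Rplus_min (S : Fin (m + u) → α × β) (d : Draws m u) (h : α × β → ℝ) : ℝ :=
  if u ≤ m then Rplus_u S d h else Rplus_m S d h

/-- `E_d [ sup_{h ∈ H} R_d h ]`. -/
noncomputable def expSup (R : Draws m u → (α × β → ℝ) → ℝ) (H : Set (α × β → ℝ)) : ℝ :=
  ∫ d, sSup (R d '' H) ∂(drawLaw m u)

/-- `Δ*_F = { ℓ_f - ℓ_{f*} : f ∈ F }`. -/
def deltaStar (ℓ : ℝ → β → ℝ) (F : Set (α → ℝ)) (fstar : α → ℝ) : Set (α × β → ℝ) :=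
  {h | ∃ f ∈ F, h = lossFun ℓ f - lossFun ℓ fstar}

/-- The localized class `{ h ∈ Δ*_F : B L_n(h) ≤ r }`. -/
def localDeltaStar (S : Fin (m + u) → α × β) (ℓ : ℝ → β → ℝ) (F : Set (α → ℝ))
    (fstar : α → ℝ) (B r : ℝ) : Set (α × β → ℝ) :=
  {h | h ∈ deltaStar ℓ F fstar ∧ B * fullAvg S h ≤ r}

/-- The Main Assumption: `f*` minimizes the full-sample loss over `F`, and
`T_n(h) ≤ B L_n(h)` on `Δ*_F`. -/
structure MainAssumption (S : Fin (m + u) → α × β) (ℓ : ℝ → β → ℝ) (F : Set (α → ℝ))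
    (fstar : α → ℝ) (B : ℝ) : Prop where
  mem : fstar ∈ F
  isMinOn : IsMinOn (fun f => fullAvg S (lossFun ℓ f)) F fstar
  sqAvg_le : ∀ h ∈ deltaStar ℓ F fstar, fullSqAvg S h ≤ B * fullAvg S h

end Functionals

/-! ### Sub-root functions -/

/-- Sub-root functions `[0,∞) → [0,∞)`; only the values on `[0,∞)` matter. -/
structure IsSubRoot (ψ : ℝ → ℝ) : Prop where
  nonneg : ∀ r, 0 ≤ r → 0 ≤ ψ r
  mono : MonotoneOn ψ (Set.Ici 0)
  anti : AntitoneOn (fun r => ψ r / √r) (Set.Ioi 0)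

/-- `r` is *the* fixed point of the sub-root function `ψ`: the largest solution of `ψ r = r` in
`[0,∞)`. A sub-root function that is not identically zero has exactly one positive fixed point,
and this is it (`0` may be a second, spurious one, as for `ψ = √`); for `ψ = 0` it is `0`. -/
def IsTheFixedPoint (ψ : ℝ → ℝ) (r : ℝ) : Prop :=
  IsGreatest {s | 0 ≤ s ∧ ψ s = s} r

end Transductive

namespace Transductive

/-! Let `g` be the excess loss of one of the two estimators. Its average over the set on which the
estimator is a minimizer is at most zero, so `L_n(g)` is at most the deviation `R⁻ g` on that set.
If moreover `r/4 < B L_n(g) ≤ r`, then the supremum of `R⁻` over the class localized at level `r`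
exceeds `r/(4B)`. It is therefore enough to make this unlikely on every shell `r = r₀ 4^(j+1)` with
`r₀ = κ² (r* + x/c)`, `c = u` or `m`. The sub-root property (`IsSubRoot.le_sqrt_mul`) gives `ψ r ≤
√(r r*) ≤ r / (κ 2^(j+1))` there, so the expected supremum is far below the threshold and what is
missing is concentration.

Concentration comes from a modified logarithmic Sobolev inequality for a uniform `k`-subset
(`card_mul_sliceEnt_le`), proved by induction on the ground set: split the entropy according to
whether a point `a` is chosen, then average over `a`. Herbst's argument turns it into a sub-Gaussian
upper tail for any function whose squared decreases under exchanges have a bounded sum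
(`card_filter_le_of_upVar_le`).

For the supremum `Z` of centered sums, that sum of squares is itself random: it involves the squares
summed over the smaller of the test and training sets. These are controlled by the supremum `W` of
centered sums of squares, which is why `R⁺_min h²` enters the hypothesis on `ψ`. The sum `Z + W` is
self-bounding (`upVar_supCentered_le`), so the square root of a shift of it is sub-Gaussian, and
squaring back yields a Bernstein-type tail in terms of the two means (`card_filter_le_supCentered`).
Here the variance is at most `r` because `T_n ≤ B L_n ≤ r` on the localized class.

The test set is a uniform `u`-subset by `integral_testSet`. In `drawLaw_real_excess_le` the shells
are summed, with the exponential tail for `x ≥ 1` and Markov's inequality for `x ≤ 1`; each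
estimator fails with probability at most `e^(-x)/2`. -/

/-! ### Convexity of the entropy integrand -/

/-- The symmetrized relative entropy integrand `(a - b) (log a - log b)`. -/
noncomputable def logDiv (a b : ℝ) : ℝ := (a - b) * (Real.log a - Real.log b)

lemma logDiv_self (a : ℝ) : logDiv a a = 0 := by simp [logDiv]

lemma logDiv_nonneg {a b : ℝ} (ha : 0 < a) (hb : 0 < b) : 0 ≤ logDiv a b := by
  unfold logDiv
  rcases le_total a b with h | h
  · exact mul_nonneg_of_nonpos_of_nonpos (by linarith)
      (by linarith [Real.log_le_log ha h])
  · exact mul_nonneg (by linarith) (by linarith [Real.log_le_log hb h])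

/-- Tangent plane of the relative entropy integrand `a log (a/b)` at `(a₀, b₀)`; it passes through
the origin by homogeneity. The proof is `log t ≤ t - 1` at `t = b a₀ / (a b₀)`. -/
lemma mul_log_sub_log_ge {a b a₀ b₀ : ℝ} (ha : 0 < a) (hb : 0 < b) (ha₀ : 0 < a₀) (hb₀ : 0 < b₀) :
    a * (Real.log a₀ - Real.log b₀) + a - b * (a₀ / b₀) ≤ a * (Real.log a - Real.log b) := by
  have h := Real.log_le_sub_one_of_pos (x := (b * a₀) / (a * b₀)) (by positivity)
  rw [Real.log_div (by positivity) (by positivity), Real.log_mul hb.ne' ha₀.ne',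
    Real.log_mul ha.ne' hb₀.ne'] at h
  have h2 := mul_le_mul_of_nonneg_left h ha.le
  have h3 : a * (b * a₀ / (a * b₀) - 1) = b * (a₀ / b₀) - a := by field_simp
  rw [h3] at h2
  linarith

/-- `logDiv` lies above its tangent planes. -/
lemma logDiv_ge_tangent {a b a₀ b₀ : ℝ} (ha : 0 < a) (hb : 0 < b) (ha₀ : 0 < a₀) (hb₀ : 0 < b₀) :
    a * (Real.log a₀ - Real.log b₀ + 1 - b₀ / a₀) + b * (Real.log b₀ - Real.log a₀ + 1 - a₀ / b₀)
      ≤ logDiv a b := by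
  have h1 := mul_log_sub_log_ge ha hb ha₀ hb₀
  have h2 := mul_log_sub_log_ge hb ha hb₀ ha₀
  unfold logDiv
  linarith

/-- Joint convexity and homogeneity of `logDiv`. -/
lemma logDiv_sum_le {ι : Type*} (s : Finset ι) (hs : s.Nonempty) (a b : ι → ℝ)
    (ha : ∀ i ∈ s, 0 < a i) (hb : ∀ i ∈ s, 0 < b i) :
    logDiv (∑ i ∈ s, a i) (∑ i ∈ s, b i) ≤ ∑ i ∈ s, logDiv (a i) (b i) := by
  have hA := Finset.sum_pos ha hs
  have hB := Finset.sum_pos hb hs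
  refine le_trans (le_of_eq ?_)
    (Finset.sum_le_sum fun i hi => logDiv_ge_tangent (ha i hi) (hb i hi) hA hB)
  rw [Finset.sum_add_distrib, ← Finset.sum_mul, ← Finset.sum_mul]
  unfold logDiv
  field_simp
  ring

/-- Concavity of `log` at the mean. This bounds the part of the entropy carried by one binary
choice, with masses `F₁, F₀` and conditional means `g₁, g₀`. -/
lemma two_point_entropy_le {F₁ F₀ g₁ g₀ p q : ℝ} (hF₁ : 0 < F₁) (hF₀ : 0 < F₀) (hg₁ : 0 < g₁)
    (hg₀ : 0 < g₀) (hp : 0 ≤ p) (hq : 0 ≤ q) (hpq : p + q = 1) :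
    F₁ * Real.log g₁ + F₀ * Real.log g₀ - (F₁ + F₀) * Real.log (p * g₁ + q * g₀) ≤
      (F₁ * q - F₀ * p) * (Real.log g₁ - Real.log g₀) := by
  have h := strictConcaveOn_log_Ioi.concaveOn.2 hg₁ hg₀ hp hq hpq
  simp only [smul_eq_mul] at h
  have h2 := mul_le_mul_of_nonneg_left h (add_pos hF₁ hF₀).le
  obtain rfl : q = 1 - p := by linarith
  linarith

/-! ### Modified logarithmic Sobolev inequality on the slice -/

section Slice

variable {α : Type*} [DecidableEq α]

lemma sum_powersetCard_succ_insert {A : Finset α} {a : α} (ha : a ∉ A) (k : ℕ)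
    (f : Finset α → ℝ) :
    ∑ S ∈ (insert a A).powersetCard (k + 1), f S =
      ∑ T ∈ A.powersetCard k, f (insert a T) + ∑ T ∈ A.powersetCard (k + 1), f T := by
  rw [Finset.powersetCard_succ_insert ha, Finset.sum_union, add_comm, Finset.sum_image]
  · intro S hS T hT h
    have hS' : a ∉ S := fun h => ha ((Finset.mem_powersetCard.1 hS).1 h)
    have hT' : a ∉ T := fun h => ha ((Finset.mem_powersetCard.1 hT).1 h)
    rw [← Finset.erase_insert hS', ← Finset.erase_insert hT', h]
  · rw [Finset.disjoint_left]
    intro S hS hS'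
    obtain ⟨T, -, rfl⟩ := Finset.mem_image.1 hS'
    exact ha ((Finset.mem_powersetCard.1 hS).1 (Finset.mem_insert_self _ _))

/-- Choosing a `k`-set and a point outside of it amounts to choosing a `(k+1)`-set and a point of
it. -/
lemma sum_powersetCard_sdiff (A : Finset α) (k : ℕ) (F : Finset α → α → ℝ) :
    ∑ T ∈ A.powersetCard k, ∑ j ∈ A \ T, F (insert j T) j =
      ∑ S ∈ A.powersetCard (k + 1), ∑ j ∈ S, F S j := by
  rw [Finset.sum_sigma', Finset.sum_sigma']
  refine Finset.sum_bij' (fun p _ => ⟨insert p.2 p.1, p.2⟩) (fun p _ => ⟨p.1.erase p.2, p.2⟩)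
    ?_ ?_ ?_ ?_ ?_
  · rintro ⟨T, j⟩ h
    simp only [Finset.mem_sigma, Finset.mem_powersetCard, Finset.mem_sdiff] at h ⊢
    refine ⟨⟨Finset.insert_subset h.2.1 h.1.1, ?_⟩, Finset.mem_insert_self _ _⟩
    rw [Finset.card_insert_of_notMem h.2.2, h.1.2]
  · rintro ⟨S, j⟩ h
    simp only [Finset.mem_sigma, Finset.mem_powersetCard, Finset.mem_sdiff] at h ⊢
    refine ⟨⟨(Finset.erase_subset _ _).trans h.1.1, ?_⟩, h.1.1 h.2, Finset.notMem_erase _ _⟩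
    rw [Finset.card_erase_of_mem h.2, h.1.2]; rfl
  · rintro ⟨T, j⟩ h
    simp only [Finset.mem_sigma, Finset.mem_sdiff] at h
    simp [Finset.erase_insert h.2.2]
  · rintro ⟨S, j⟩ h
    simp only [Finset.mem_sigma] at h
    simp [Finset.insert_erase h.2]
  · rintro ⟨T, j⟩ h
    rfl

/-- The unnormalized entropy of `f` on the `k`-subsets of `A`. -/
noncomputable def sliceEnt (A : Finset α) (k : ℕ) (f : Finset α → ℝ) : ℝ :=
  ∑ S ∈ A.powersetCard k, f S * Real.log (f S) -
    (∑ S ∈ A.powersetCard k, f S) *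
      Real.log ((∑ S ∈ A.powersetCard k, f S) / (A.card.choose k : ℝ))

/-- The unnormalized Dirichlet form `∑ (f S - f S') (log f S - log f S')` over the ordered pairs of
neighbouring `k`-subsets `S, S'` of `A`, written through their intersection. -/
noncomputable def sliceDir (A : Finset α) : ℕ → (Finset α → ℝ) → ℝ
  | 0, _ => 0
  | k + 1, f => ∑ T ∈ A.powersetCard k, ∑ i ∈ A \ T, ∑ j ∈ A \ T,
      logDiv (f (insert i T)) (f (insert j T))

lemma sliceDir_nonneg (A : Finset α) (k : ℕ) (f : Finset α → ℝ) (hf : ∀ S, 0 < f S) :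
    0 ≤ sliceDir A k f := by
  cases k with
  | zero => exact le_rfl
  | succ k =>
    exact Finset.sum_nonneg fun _ _ => Finset.sum_nonneg fun _ _ => Finset.sum_nonneg fun _ _ =>
      logDiv_nonneg (hf _) (hf _)

/-- Conditioning on `a` keeps exactly the exchanges that do not move `a`. The two forms on the left
collect the common parts `T` with and without `a`. -/
lemma sliceDir_erase (A : Finset α) (k : ℕ) (f : Finset α → ℝ) {a : α} (ha : a ∈ A) :
    sliceDir (A.erase a) k (fun T => f (insert a T)) + sliceDir (A.erase a) (k + 1) f =
      ∑ T ∈ A.powersetCard k, ∑ i ∈ A.erase a \ T, ∑ j ∈ A.erase a \ T,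
        logDiv (f (insert i T)) (f (insert j T)) := by
  cases k with
  | zero => simp [sliceDir]
  | succ k =>
    have hA : insert a (A.erase a) = A := Finset.insert_erase ha
    have ha' : a ∉ A.erase a := Finset.notMem_erase _ _
    have h := sum_powersetCard_succ_insert ha' k (fun T => ∑ i ∈ A.erase a \ T,
      ∑ j ∈ A.erase a \ T, logDiv (f (insert i T)) (f (insert j T)))
    rw [hA] at h
    rw [h]
    simp only [sliceDir]
    congr 1
    refine Finset.sum_congr rfl fun T _ => ?_
    rw [Finset.sdiff_insert, Finset.erase_eq_of_notMem (s := A.erase a \ T) (a := a) (by simp)]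
    simp only [Finset.insert_comm a]

/-- An off-diagonal pair survives the deletion of all but two of the points `a`, and the diagonal
contributes nothing. -/
lemma sum_sum_erase (A B : Finset α) (hBA : B ⊆ A) (d : α → α → ℝ) (hd : ∀ i, d i i = 0) :
    ∑ a ∈ A, ∑ i ∈ B.erase a, ∑ j ∈ B.erase a, d i j =
      ((A.card : ℝ) - 2) * ∑ i ∈ B, ∑ j ∈ B, d i j := by
  have h1 : ∀ a ∈ A, ∑ i ∈ B.erase a, ∑ j ∈ B.erase a, d i j =
      ∑ i ∈ B, ∑ j ∈ B, if a ≠ i ∧ a ≠ j then d i j else 0 := by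
    intro a _
    rw [← Finset.filter_ne B a, Finset.sum_filter]
    refine Finset.sum_congr rfl fun i _ => ?_
    rw [Finset.sum_filter]
    split_ifs with h
    · exact Finset.sum_congr rfl fun j _ => by simp [h]
    · simp [h]
  rw [Finset.sum_congr rfl h1, Finset.sum_comm, Finset.mul_sum]
  refine Finset.sum_congr rfl fun i hi => ?_
  rw [Finset.sum_comm, Finset.mul_sum]
  refine Finset.sum_congr rfl fun j hj => ?_
  by_cases hij : i = j
  · subst hij; simp [hd]
  rw [← Finset.sum_filter, Finset.sum_const, nsmul_eq_mul]
  congr 1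
  have : A.filter (fun a => a ≠ i ∧ a ≠ j) = (A.erase i).erase j := by
    ext a; simp; tauto
  rw [this, Finset.card_erase_of_mem (Finset.mem_erase.2 ⟨Ne.symm hij, hBA hj⟩),
    Finset.card_erase_of_mem (hBA hi)]
  have h2 : 2 ≤ A.card := by
    have := Finset.card_le_card (Finset.insert_subset (hBA hi) (Finset.singleton_subset_iff.2 (hBA hj)))
    rwa [Finset.card_pair hij] at this
  rw [Nat.sub_sub, Nat.cast_sub h2]; norm_num

lemma sum_sliceDir_erase (A : Finset α) (k : ℕ) (f : Finset α → ℝ) :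
    ∑ a ∈ A, (sliceDir (A.erase a) k (fun T => f (insert a T)) + sliceDir (A.erase a) (k + 1) f) =
      ((A.card : ℝ) - 2) * sliceDir A (k + 1) f := by
  rw [Finset.sum_congr rfl fun a ha => sliceDir_erase A k f ha, Finset.sum_comm]
  simp only [sliceDir]
  rw [Finset.mul_sum]
  refine Finset.sum_congr rfl fun T _ => ?_
  simp only [Finset.erase_sdiff_comm]
  exact sum_sum_erase A (A \ T) Finset.sdiff_subset
    (fun i j => logDiv (f (insert i T)) (f (insert j T))) (fun i => logDiv_self _)

/-- Each ordered exchange is counted once, with `a` the point that belongs to the first set only. -/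
lemma sum_erase_eq_sliceDir (A : Finset α) (k : ℕ) (f : Finset α → ℝ) :
    ∑ a ∈ A, ∑ T ∈ (A.erase a).powersetCard k, ∑ j ∈ A.erase a \ T,
      logDiv (f (insert a T)) (f (insert j T)) = sliceDir A (k + 1) f := by
  simp only [sliceDir]
  rw [Finset.sum_comm' (t' := A.powersetCard k) (s' := fun T => A \ T)]
  · refine Finset.sum_congr rfl fun T _ => Finset.sum_congr rfl fun i hi => ?_
    rw [Finset.erase_sdiff_comm]
    exact Finset.sum_erase _ (logDiv_self _)
  · intro a T
    simp only [Finset.mem_powersetCard, Finset.mem_sdiff, Finset.subset_erase]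
    tauto

/-- One step of the entropy recursion: conditioning on whether `a` is chosen. -/
lemma sliceEnt_insert_le {A : Finset α} {a : α} (ha : a ∉ A) {k : ℕ} (hk : k + 1 ≤ A.card)
    (f : Finset α → ℝ) (hf : ∀ S, 0 < f S) :
    sliceEnt (insert a A) (k + 1) f ≤
      sliceEnt A k (fun T => f (insert a T)) + sliceEnt A (k + 1) f +
        (1 / ((A.card : ℝ) + 1)) * ∑ T ∈ A.powersetCard k, ∑ j ∈ A \ T,
          logDiv (f (insert a T)) (f (insert j T)) := by
  obtain ⟨l, hl⟩ : ∃ l, A.card = k + 1 + l := ⟨A.card - (k + 1), by omega⟩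
  have hne1 : (A.powersetCard k).Nonempty := Finset.powersetCard_nonempty.2 (by omega)
  have hne0 : (A.powersetCard (k + 1)).Nonempty := Finset.powersetCard_nonempty.2 hk
  have hcT : ∀ T ∈ A.powersetCard k, (A \ T).card = l + 1 := by
    intro T hT
    rw [Finset.mem_powersetCard] at hT
    rw [Finset.card_sdiff_of_subset hT.1]; omega
  unfold sliceEnt
  rw [sum_powersetCard_succ_insert ha, sum_powersetCard_succ_insert ha,
    Finset.card_insert_of_notMem ha]
  set F₁ := ∑ T ∈ A.powersetCard k, f (insert a T) with hF₁
  set F₀ := ∑ T ∈ A.powersetCard (k + 1), f T with hF₀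
  have h1 : 0 < F₁ := Finset.sum_pos (fun _ _ => hf _) hne1
  have h0 : 0 < F₀ := Finset.sum_pos (fun _ _ => hf _) hne0
  -- Both arguments are sums over the same pairs `(T, j)`, so joint convexity compares the total
  -- masses with the individual exchanges of `a` against `j`.
  have hX : logDiv (((l : ℝ) + 1) * F₁) (((k : ℝ) + 1) * F₀) ≤
      ∑ T ∈ A.powersetCard k, ∑ j ∈ A \ T, logDiv (f (insert a T)) (f (insert j T)) := by
    have e1 : ((l : ℝ) + 1) * F₁ = ∑ T ∈ A.powersetCard k, ∑ j ∈ A \ T, f (insert a T) := by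
      rw [hF₁, Finset.mul_sum]
      refine Finset.sum_congr rfl fun T hT => ?_
      rw [Finset.sum_const, hcT T hT, nsmul_eq_mul]; push_cast; ring
    have e0 : ((k : ℝ) + 1) * F₀ = ∑ T ∈ A.powersetCard k, ∑ j ∈ A \ T, f (insert j T) := by
      rw [sum_powersetCard_sdiff A k (fun S _ => f S), hF₀, Finset.mul_sum]
      refine Finset.sum_congr rfl fun T hT => ?_
      rw [Finset.sum_const, (Finset.mem_powersetCard.1 hT).2, nsmul_eq_mul]; push_cast; ring
    rw [e1, e0, Finset.sum_sigma', Finset.sum_sigma', Finset.sum_sigma']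
    refine logDiv_sum_le _ ?_ _ _ (fun _ _ => hf _) (fun _ _ => hf _)
    obtain ⟨T, hT⟩ := hne1
    obtain ⟨j, hj⟩ : (A \ T).Nonempty := Finset.card_pos.1 (by rw [hcT T hT]; omega)
    exact ⟨⟨T, j⟩, Finset.mem_sigma.2 ⟨hT, hj⟩⟩
  have hN1 : 0 < (A.card.choose k : ℝ) := by exact_mod_cast Nat.choose_pos (by omega)
  have hN0 : 0 < (A.card.choose (k + 1) : ℝ) := by exact_mod_cast Nat.choose_pos hk
  have hrel : (A.card.choose (k + 1) : ℝ) * (k + 1) = (A.card.choose k : ℝ) * (l + 1) := by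
    have := Nat.choose_succ_right_eq A.card k
    rw [show A.card - k = l + 1 by omega] at this
    exact_mod_cast this
  have hN : ((A.card + 1).choose (k + 1) : ℝ) =
      (A.card.choose k : ℝ) + (A.card.choose (k + 1) : ℝ) := by
    rw [Nat.choose_succ_succ]; push_cast; rfl
  have hn : (A.card : ℝ) + 1 = (k + 1) + (l + 1) := by rw [hl]; push_cast; ring
  rw [hN, hn]
  set N₁ : ℝ := (A.card.choose k : ℝ)
  set N₀ : ℝ := (A.card.choose (k + 1) : ℝ)
  have hN0' : N₀ = N₁ * (l + 1) / (k + 1) := by field_simp; linarith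
  -- `p` is the probability that a uniform `(k+1)`-subset of the enlarged set contains the new
  -- point.
  have key := two_point_entropy_le (F₁ := F₁) (F₀ := F₀) (g₁ := F₁ / N₁) (g₀ := F₀ / N₀)
    (p := (k + 1) / ((k + 1) + (l + 1))) (q := (l + 1) / ((k + 1) + (l + 1))) h1 h0
    (by positivity) (by positivity) (by positivity) (by positivity) (by field_simp)
  have e1 : ((k : ℝ) + 1) / ((k + 1) + (l + 1)) * (F₁ / N₁) +
      (l + 1) / ((k + 1) + (l + 1)) * (F₀ / N₀) = (F₁ + F₀) / (N₁ + N₀) := by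
    rw [hN0']; field_simp
  have e2 : Real.log (F₁ / N₁) - Real.log (F₀ / N₀) =
      Real.log (((l : ℝ) + 1) * F₁) - Real.log (((k : ℝ) + 1) * F₀) := by
    rw [← Real.log_div (by positivity) (by positivity),
      ← Real.log_div (by positivity) (by positivity), hN0']
    congr 1; field_simp
  rw [e1, e2] at key
  have e3 : (F₁ * (((l : ℝ) + 1) / ((k + 1) + (l + 1))) -
      F₀ * (((k : ℝ) + 1) / ((k + 1) + (l + 1)))) *
      (Real.log (((l : ℝ) + 1) * F₁) - Real.log (((k : ℝ) + 1) * F₀)) =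
      (1 / (((k : ℝ) + 1) + (l + 1))) * logDiv (((l : ℝ) + 1) * F₁) (((k : ℝ) + 1) * F₀) := by
    unfold logDiv; field_simp
  rw [e3] at key
  have hX' := mul_le_mul_of_nonneg_left hX
    (show (0 : ℝ) ≤ 1 / (((k : ℝ) + 1) + (l + 1)) by positivity)
  linarith

omit [DecidableEq α] in
lemma sliceEnt_zero (A : Finset α) (f : Finset α → ℝ) : sliceEnt A 0 f = 0 := by
  simp [sliceEnt]

omit [DecidableEq α] in
lemma sliceEnt_card (A : Finset α) (f : Finset α → ℝ) : sliceEnt A A.card f = 0 := by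
  simp [sliceEnt]

/-- Modified logarithmic Sobolev inequality for the uniform measure on the `k`-subsets of `A`. -/
theorem card_mul_sliceEnt_le (A : Finset α) (k : ℕ) (hk : k ≤ A.card) (f : Finset α → ℝ)
    (hf : ∀ S, 0 < f S) : (A.card : ℝ) * sliceEnt A k f ≤ sliceDir A k f := by
  induction hn : A.card generalizing A k f with
  | zero =>
    obtain rfl : k = 0 := by omega
    simp [sliceEnt_zero, sliceDir]
  | succ n ih =>
    rcases hk.eq_or_lt with h | hlt
    · rw [h, sliceEnt_card, mul_zero, ← h]
      exact sliceDir_nonneg A k f hf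
    rcases k with _ | k
    · simp [sliceEnt_zero, sliceDir]
    have hn1 : (1 : ℝ) ≤ n := by
      have : 1 ≤ n := by omega
      exact_mod_cast this
    have hstep : ∀ a ∈ A, sliceEnt A (k + 1) f ≤
        (1 / (n : ℝ)) * (sliceDir (A.erase a) k (fun T => f (insert a T)) +
          sliceDir (A.erase a) (k + 1) f) +
        (1 / ((n : ℝ) + 1)) * ∑ T ∈ (A.erase a).powersetCard k, ∑ j ∈ A.erase a \ T,
          logDiv (f (insert a T)) (f (insert j T)) := by
      intro a ha
      have hc : (A.erase a).card = n := by rw [Finset.card_erase_of_mem ha, hn]; rfl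
      have h := sliceEnt_insert_le (Finset.notMem_erase a A) (k := k) (by omega) f hf
      rw [Finset.insert_erase ha, hc] at h
      have i1 := ih (A.erase a) k (by omega) (fun T => f (insert a T)) (fun _ => hf _) hc
      have i2 := ih (A.erase a) (k + 1) (by omega) f hf hc
      have i3 : sliceEnt (A.erase a) k (fun T => f (insert a T)) +
          sliceEnt (A.erase a) (k + 1) f ≤ (1 / (n : ℝ)) *
          (sliceDir (A.erase a) k (fun T => f (insert a T)) + sliceDir (A.erase a) (k + 1) f) := by
        rw [one_div, ← div_eq_inv_mul, le_div_iff₀ (by linarith)]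
        linarith
      linarith
    have hsum := Finset.sum_le_sum hstep
    rw [Finset.sum_const, nsmul_eq_mul, Finset.sum_add_distrib, ← Finset.mul_sum, ← Finset.mul_sum,
      sum_sliceDir_erase, sum_erase_eq_sliceDir, hn] at hsum
    refine hsum.trans ?_
    have hD := sliceDir_nonneg A (k + 1) f hf
    push_cast
    -- The induction closes since `(n-1)/n + 1/(n+1) ≤ 1`: the weight lost by conditioning pays for
    -- the exchanges that move `a`.
    have : 1 / (n : ℝ) * (((n : ℝ) + 1 - 2)) + 1 / ((n : ℝ) + 1) ≤ 1 := by
      rw [div_mul_eq_mul_div, div_add_div _ _ (by positivity) (by positivity),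
        div_le_one (by positivity)]
      nlinarith
    nlinarith

end Slice


/-! ### From entropy to tails -/

/-- Herbst's argument for the uniform measure on a finite set. -/
lemma herbst {ι : Type*} (s : Finset ι) (hs : s.Nonempty) (Y : ι → ℝ) (v : ℝ)
    (h : ∀ t : ℝ, 0 < t → t * ∑ i ∈ s, Y i * Real.exp (t * Y i) -
      (∑ i ∈ s, Real.exp (t * Y i)) * Real.log ((∑ i ∈ s, Real.exp (t * Y i)) / s.card) ≤
        v * t ^ 2 * ∑ i ∈ s, Real.exp (t * Y i)) {t : ℝ} (ht : 0 < t) :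
    (∑ i ∈ s, Real.exp (t * Y i)) / s.card ≤
      Real.exp (t * ((∑ i ∈ s, Y i) / s.card) + v * t ^ 2) := by
  have hN : (0 : ℝ) < s.card := by exact_mod_cast hs.card_pos
  set M : ℝ → ℝ := fun t => ∑ i ∈ s, Real.exp (t * Y i) with hM
  set M' : ℝ → ℝ := fun t => ∑ i ∈ s, Y i * Real.exp (t * Y i) with hM'
  have hMpos : ∀ t, 0 < M t := fun t => Finset.sum_pos (fun _ _ => Real.exp_pos _) hs
  have hMd : ∀ t, HasDerivAt M (M' t) t := by
    intro t
    refine HasDerivAt.fun_sum fun i _ => ?_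
    have := ((hasDerivAt_id t).mul_const (Y i)).exp
    simpa [mul_comm] using this
  set φ : ℝ → ℝ := fun t => Real.log (M t / s.card) with hφ
  have hφd : ∀ t, HasDerivAt φ (M' t / M t) t := by
    intro t
    have := ((hMd t).div_const (s.card : ℝ)).log (div_pos (hMpos t) hN).ne'
    convert this using 1
    have := (hMpos t).ne'
    field_simp
  have hφ0 : φ 0 = 0 := by simp [hφ, hM, hN.ne']
  have hψd : ∀ t ∈ Set.Ioi (0 : ℝ), HasDerivAt (fun t => φ t / t - v * t)
      ((M' t / M t * t - φ t * 1) / t ^ 2 - v * 1) t := by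
    intro t ht
    exact ((hφd t).div (hasDerivAt_id t) (ne_of_gt ht)).sub ((hasDerivAt_id t).const_mul v)
  -- The entropy bound says precisely that `φ t / t`, with `φ` the logarithmic moment generating
  -- function, has derivative at most `v`.
  have hanti : AntitoneOn (fun t => φ t / t - v * t) (Set.Ioi 0) := by
    refine antitoneOn_of_deriv_nonpos (convex_Ioi 0)
      (fun t ht => (hψd t ht).continuousAt.continuousWithinAt) ?_ ?_
    · rw [interior_Ioi]
      exact fun t ht => (hψd t ht).differentiableAt.differentiableWithinAt
    · rw [interior_Ioi]
      intro t ht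
      have ht' : 0 < t := ht
      rw [(hψd t ht).deriv, mul_one, mul_one, sub_nonpos, div_le_iff₀ (by positivity)]
      have h1 := h t ht
      have h2 : M' t / M t * t - φ t = (t * M' t - M t * φ t) / M t := by
        have := (hMpos t).ne'
        field_simp
      rw [h2, div_le_iff₀ (hMpos t)]
      exact h1
  -- Since `φ 0 = 0`, the quotient is a slope, and its limit at `0` is `φ' 0`, the mean of `Y`.
  have hlim : Filter.Tendsto (fun t => φ t / t - v * t) (nhdsWithin 0 (Set.Ioi 0))
      (nhds ((∑ i ∈ s, Y i) / s.card)) := by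
    have h1 := (hasDerivAt_iff_tendsto_slope.1 (hφd 0)).mono_left
      (nhdsWithin_mono (0 : ℝ) (s := Set.Ioi 0) (t := {0}ᶜ) (fun t ht => ne_of_gt ht))
    have h2 : Filter.Tendsto (fun t : ℝ => v * t) (nhdsWithin 0 (Set.Ioi 0)) (nhds (v * 0)) :=
      ((continuous_const.mul continuous_id).tendsto 0).mono_left nhdsWithin_le_nhds
    have h3 := h1.sub h2
    have h4 : M' 0 / M 0 - v * 0 = (∑ i ∈ s, Y i) / s.card := by simp [hM, hM']
    rw [h4] at h3
    refine h3.congr fun t => ?_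
    simp [slope_def_field, hφ0]
  have hle : φ t / t - v * t ≤ (∑ i ∈ s, Y i) / s.card := by
    refine ge_of_tendsto hlim ?_
    filter_upwards [Ioo_mem_nhdsGT ht] with r hr
    exact hanti hr.1 ht hr.2.le
  have h5 : φ t ≤ t * ((∑ i ∈ s, Y i) / s.card) + v * t ^ 2 := by
    have : φ t / t ≤ (∑ i ∈ s, Y i) / s.card + v * t := by linarith
    rw [div_le_iff₀ ht] at this
    linarith
  exact (Real.log_le_iff_le_exp (div_pos (hMpos t) hN)).1 h5

/-- Chernoff's bound for the uniform measure on a finite set. -/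
lemma card_filter_le_of_exp_moment {ι : Type*} (s : Finset ι) (hs : s.Nonempty) (Y : ι → ℝ)
    {v : ℝ} (hv : 0 < v) (E : ℝ)
    (h : ∀ t : ℝ, 0 < t → (∑ i ∈ s, Real.exp (t * Y i)) / s.card ≤
      Real.exp (t * E + v * t ^ 2)) {x : ℝ} (hx : 0 < x) :
    ((s.filter fun i => E + 2 * √(v * x) ≤ Y i).card : ℝ) ≤ Real.exp (-x) * s.card := by
  have hN : (0 : ℝ) < s.card := by exact_mod_cast hs.card_pos
  -- Minimizer of `v t² - 2 t √(v x)`, with minimum `-x`.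
  set t := √(x / v) with ht
  have htpos : 0 < t := Real.sqrt_pos.2 (by positivity)
  have h1 := (div_le_iff₀ hN).1 (h t htpos)
  have h2 : ((s.filter fun i => E + 2 * √(v * x) ≤ Y i).card : ℝ) *
      Real.exp (t * (E + 2 * √(v * x))) ≤ ∑ i ∈ s, Real.exp (t * Y i) := by
    rw [← nsmul_eq_mul, ← Finset.sum_const]
    refine (Finset.sum_le_sum fun i hi => ?_).trans
      (Finset.sum_le_sum_of_subset_of_nonneg (Finset.filter_subset _ s)
        fun _ _ _ => (Real.exp_pos _).le)
    exact Real.exp_le_exp.2 (mul_le_mul_of_nonneg_left (Finset.mem_filter.1 hi).2 htpos.le)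
  have h3 : t * √(v * x) = x := by
    rw [ht, ← Real.sqrt_mul (by positivity), show x / v * (v * x) = x ^ 2 by field_simp,
      Real.sqrt_sq hx.le]
  have h4 : v * t ^ 2 = x := by rw [ht, Real.sq_sqrt (by positivity)]; field_simp
  have h5 := h2.trans h1
  rw [← le_div_iff₀ (Real.exp_pos _), mul_div_right_comm, ← Real.exp_sub] at h5
  refine h5.trans (le_of_eq ?_)
  congr 2
  linarith [mul_add t E (2 * √(v * x))]

/-- By convexity of `exp` the cost is charged to the larger endpoint alone. Hence only decreases of
`Y` matter below, and the variance bound can be one-sided. -/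
lemma logDiv_exp_le (a b : ℝ) :
    logDiv (Real.exp a) (Real.exp b) ≤
      Real.exp a * (max (a - b) 0) ^ 2 + Real.exp b * (max (b - a) 0) ^ 2 := by
  have key : ∀ a b : ℝ, b ≤ a → (Real.exp a - Real.exp b) * (a - b) ≤
      Real.exp a * (a - b) ^ 2 := by
    intro a b hab
    have h1 : Real.exp a * (b - a + 1) ≤ Real.exp b := by
      have := mul_le_mul_of_nonneg_left (Real.add_one_le_exp (b - a)) (Real.exp_pos a).le
      rwa [← Real.exp_add, add_sub_cancel] at this
    have h2 : Real.exp a - Real.exp b ≤ Real.exp a * (a - b) := by linarith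
    have := mul_le_mul_of_nonneg_right h2 (sub_nonneg.2 hab)
    linarith
  unfold logDiv
  rw [Real.log_exp, Real.log_exp]
  rcases le_total b a with h | h
  · rw [max_eq_left (by linarith), max_eq_right (by linarith)]
    linarith [key a b h]
  · rw [max_eq_right (by linarith), max_eq_left (by linarith)]
    linarith [key b a h]

/-! ### Upper tails from one-sided exchange variance -/

section Slice

variable {α : Type*} [DecidableEq α]

/-- Sum over the neighbours `S'` of `S` of `(Y S - Y S')₊²`. -/
noncomputable def upVar (A : Finset α) (Y : Finset α → ℝ) (S : Finset α) : ℝ :=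
  ∑ i ∈ S, ∑ j ∈ A \ S, (max (Y S - Y (insert j (S.erase i))) 0) ^ 2

lemma sliceDir_exp_le (A : Finset α) (k : ℕ) (Y : Finset α → ℝ) :
    sliceDir A (k + 1) (fun S => Real.exp (Y S)) ≤
      2 * ∑ S ∈ A.powersetCard (k + 1), Real.exp (Y S) * upVar A Y S := by
  have h1 : sliceDir A (k + 1) (fun S => Real.exp (Y S)) ≤
      2 * ∑ T ∈ A.powersetCard k, ∑ i ∈ A \ T, ∑ j ∈ A \ T,
        Real.exp (Y (insert i T)) * (max (Y (insert i T) - Y (insert j T)) 0) ^ 2 := by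
    simp only [sliceDir]
    rw [Finset.mul_sum]
    refine Finset.sum_le_sum fun T _ => ?_
    refine (Finset.sum_le_sum fun i _ => Finset.sum_le_sum fun j _ =>
      logDiv_exp_le _ _).trans (le_of_eq ?_)
    simp only [Finset.sum_add_distrib]
    rw [two_mul]
    congr 1
    exact Finset.sum_comm
  refine h1.trans (le_of_eq ?_)
  congr 1
  have h2 := sum_powersetCard_sdiff A k (fun S i => ∑ j ∈ A \ S.erase i,
    Real.exp (Y S) * (max (Y S - Y (insert j (S.erase i))) 0) ^ 2)
  have h3 : ∀ T ∈ A.powersetCard k, ∑ i ∈ A \ T, ∑ j ∈ A \ T,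
        Real.exp (Y (insert i T)) * (max (Y (insert i T) - Y (insert j T)) 0) ^ 2 =
      ∑ i ∈ A \ T, ∑ j ∈ A \ (insert i T).erase i, Real.exp (Y (insert i T)) *
        (max (Y (insert i T) - Y (insert j ((insert i T).erase i))) 0) ^ 2 := by
    intro T _
    refine Finset.sum_congr rfl fun i hi => ?_
    rw [Finset.erase_insert (Finset.mem_sdiff.1 hi).2]
  rw [Finset.sum_congr rfl h3, h2]
  refine Finset.sum_congr rfl fun S hS => ?_
  unfold upVar
  rw [Finset.mul_sum]
  refine Finset.sum_congr rfl fun i hi => ?_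
  have hiA : i ∈ A := (Finset.mem_powersetCard.1 hS).1 hi
  -- The additional term `j = i` exchanges nothing and vanishes.
  have : A \ S.erase i = insert i (A \ S) := by
    ext j; by_cases hj : j = i
    · subst hj; simp [hiA]
    · simp [hj]
  rw [this, Finset.sum_insert (by simp [hi]), Finset.insert_erase hi, Finset.mul_sum]
  simp

/-- Sub-Gaussian upper tail on the slice under a one-sided variance bound. -/
theorem card_filter_le_of_upVar_le (A : Finset α) (k : ℕ) (hk : 0 < k) (hkA : k ≤ A.card)
    (Y : Finset α → ℝ) {v : ℝ} (hv : 0 < v)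
    (h : ∀ S ∈ A.powersetCard k, 2 * upVar A Y S ≤ v * A.card) {x : ℝ} (hx : 0 < x) :
    (((A.powersetCard k).filter fun S => (∑ S ∈ A.powersetCard k, Y S) / (A.card.choose k : ℝ) +
      2 * √(v * x) ≤ Y S).card : ℝ) ≤ Real.exp (-x) * (A.card.choose k : ℝ) := by
  obtain ⟨k, rfl⟩ : ∃ l, k = l + 1 := ⟨k - 1, by omega⟩
  have hne : (A.powersetCard (k + 1)).Nonempty := Finset.powersetCard_nonempty.2 hkA
  have hA : (0 : ℝ) < A.card := by
    have : 0 < A.card := by omega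
    exact_mod_cast this
  rw [← Finset.card_powersetCard]
  refine card_filter_le_of_exp_moment _ hne Y hv _ (fun t ht => herbst _ hne Y v ?_ ht) hx
  intro t ht
  have h1 := card_mul_sliceEnt_le A (k + 1) hkA (fun S => Real.exp (t * Y S))
    (fun _ => Real.exp_pos _)
  have h2 := sliceDir_exp_le A k (fun S => t * Y S)
  have h3 : 2 * ∑ S ∈ A.powersetCard (k + 1), Real.exp (t * Y S) *
      upVar A (fun S => t * Y S) S ≤
      A.card * (v * t ^ 2 * ∑ S ∈ A.powersetCard (k + 1), Real.exp (t * Y S)) := by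
    rw [Finset.mul_sum, Finset.mul_sum, Finset.mul_sum]
    refine Finset.sum_le_sum fun S hS => ?_
    have e : upVar A (fun S => t * Y S) S = t ^ 2 * upVar A Y S := by
      unfold upVar
      simp only [Finset.mul_sum]
      refine Finset.sum_congr rfl fun i _ => Finset.sum_congr rfl fun j _ => ?_
      rw [← mul_sub, ← mul_pow, mul_max_of_nonneg _ _ ht.le, mul_zero]
    rw [e]
    have := mul_le_mul_of_nonneg_left (h S hS)
      (mul_pos (Real.exp_pos (t * Y S)) (pow_pos ht 2)).le
    linarith
  have h4 := le_of_mul_le_mul_left ((h1.trans h2).trans h3) hA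
  refine le_trans (le_of_eq ?_) h4
  unfold sliceEnt
  rw [Finset.card_powersetCard, Finset.mul_sum]
  congr 1
  refine Finset.sum_congr rfl fun S _ => ?_
  rw [Real.log_exp]; ring

end Slice


/-! ### Elementary inequalities -/

lemma max_add_sq_le (a b : ℝ) : (max (a + b) 0) ^ 2 ≤ 2 * (max a 0) ^ 2 + 2 * (max b 0) ^ 2 := by
  have h1 : max (a + b) 0 ≤ max a 0 + max b 0 :=
    max_le (add_le_add (le_max_left _ _) (le_max_left _ _))
      (add_nonneg (le_max_right _ _) (le_max_right _ _))
  have h2 := pow_le_pow_left₀ (le_max_right (a + b) 0) h1 2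
  nlinarith [sq_nonneg (max a 0 - max b 0)]

lemma max_sub_sq_le (a b : ℝ) : (max (a - b) 0) ^ 2 ≤ 2 * a ^ 2 + 2 * b ^ 2 := by
  rcases le_total (a - b) 0 with h | h
  · rw [max_eq_right h, zero_pow two_ne_zero]; positivity
  · rw [max_eq_left h]; nlinarith [sq_nonneg (a + b)]

/-- The positive part removes `b` altogether, so in an exchange only the square on one side is
charged. -/
lemma max_sq_sub_sq_le {a b L : ℝ} (ha : |a| ≤ L) :
    (max (a ^ 2 - b ^ 2) 0) ^ 2 ≤ L ^ 2 * a ^ 2 := by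
  have h1 : max (a ^ 2 - b ^ 2) 0 ≤ a ^ 2 := max_le (by nlinarith [sq_nonneg b]) (sq_nonneg a)
  have h2 := pow_le_pow_left₀ (le_max_right (a ^ 2 - b ^ 2) 0) h1 2
  have h3 : a ^ 2 ≤ L ^ 2 := by
    rw [← sq_abs a]; exact pow_le_pow_left₀ (abs_nonneg a) ha 2
  nlinarith [mul_le_mul_of_nonneg_right h3 (sq_nonneg a)]

lemma max_sqrt_sub_sqrt_sq_le {p q : ℝ} (hp : 0 < p) (hq : 0 ≤ q) :
    (max (√p - √q) 0) ^ 2 ≤ (max (p - q) 0) ^ 2 / p := by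
  rcases le_total p q with h | h
  · rw [max_eq_right (sub_nonpos.2 (Real.sqrt_le_sqrt h)), zero_pow two_ne_zero]
    positivity
  · have h1 := Real.sqrt_le_sqrt h
    rw [max_eq_left (sub_nonneg.2 h1), max_eq_left (sub_nonneg.2 h), le_div_iff₀ hp]
    have h2 : √p * (√p - √q) ≤ p - q := by
      have := mul_le_mul_of_nonneg_right h1 (Real.sqrt_nonneg q)
      rw [Real.mul_self_sqrt hq] at this
      rw [mul_sub, Real.mul_self_sqrt hp.le]
      linarith
    have h3 := pow_le_pow_left₀ (mul_nonneg (Real.sqrt_nonneg p) (sub_nonneg.2 h1)) h2 2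
    rw [mul_pow, Real.sq_sqrt hp.le] at h3
    linarith

lemma add_sq_le_of_pos (a b : ℝ) {ε : ℝ} (hε : 0 < ε) :
    (a + b) ^ 2 ≤ (1 + ε) * a ^ 2 + (1 + 1 / ε) * b ^ 2 := by
  have h : (1 + ε) * a ^ 2 + (1 + 1 / ε) * b ^ 2 - (a + b) ^ 2 = (ε * a - b) ^ 2 / ε := by
    field_simp; ring
  have : 0 ≤ (ε * a - b) ^ 2 / ε := by positivity
  linarith

lemma nonempty_of_mem {β : Type*} {s : Finset β} {b : β} (h : b ∈ s) : s.Nonempty := ⟨b, h⟩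

/-! ### Concentration of suprema under sampling without replacement -/

section Centered

variable {α : Type*} [Fintype α] [DecidableEq α]

/-- The sum of `q` over `S`, minus its mean when `S` is a uniform `u`-subset. -/
noncomputable def centeredSum (u : ℕ) (q : α → ℝ) (S : Finset α) : ℝ :=
  ∑ i ∈ S, q i - u * ((∑ i, q i) / Fintype.card α)

lemma centeredSum_sub_exchange (u : ℕ) (q : α → ℝ) {S : Finset α} {i j : α} (hi : i ∈ S)
    (hj : j ∉ S) : centeredSum u q S - centeredSum u q (insert j (S.erase i)) = q i - q j := by
  unfold centeredSum
  rw [Finset.sum_insert (fun h => hj (Finset.mem_of_mem_erase h)), ← Finset.add_sum_erase S q hi]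
  ring

/-- The supremum of the centered sums over a finite class of functions. -/
noncomputable def supCentered (K : Finset (α → ℝ)) (hK : K.Nonempty) (u : ℕ)
    (S : Finset α) : ℝ :=
  K.sup' hK fun h => centeredSum u h S

/-- The supremum of the signed centered sums of squares, normalized by `min u m`. -/
noncomputable def supCenteredSq (K : Finset (α → ℝ)) (hK : K.Nonempty) (m u : ℕ)
    (S : Finset α) : ℝ :=
  K.sup' hK fun h => (if u ≤ m then 1 else -1) * centeredSum u (h ^ 2) S

variable {K : Finset (α → ℝ)} {m u : ℕ}

omit [DecidableEq α] in
lemma supCentered_nonneg (h0 : 0 ∈ K) (S : Finset α) : 0 ≤ supCentered K (nonempty_of_mem h0) u S := by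
  refine le_trans (le_of_eq ?_) (Finset.le_sup' (fun h => centeredSum u h S) h0)
  simp [centeredSum]

omit [DecidableEq α] in
lemma supCenteredSq_nonneg (h0 : 0 ∈ K) (S : Finset α) :
    0 ≤ supCenteredSq K (nonempty_of_mem h0) m u S := by
  refine le_trans (le_of_eq ?_)
    (Finset.le_sup' (fun h => (if u ≤ m then 1 else -1) * centeredSum u (h ^ 2) S) h0)
  simp [centeredSum]

lemma sum_sum_compl_add (S : Finset α) (hS : S.card = u) (hn : Fintype.card α = m + u)
    (p q : α → ℝ) :
    ∑ i ∈ S, ∑ j ∈ Finset.univ \ S, (p i + q j) =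
      m * ∑ i ∈ S, p i + u * ∑ j ∈ Finset.univ \ S, q j := by
  have hc : (Finset.univ \ S).card = m := by
    rw [Finset.card_sdiff_of_subset (Finset.subset_univ S), Finset.card_univ]; omega
  simp only [Finset.sum_add_distrib, Finset.sum_const, hc, hS, nsmul_eq_mul, ← Finset.mul_sum]

/-- Self-bounding property. The maximizers at `S` still compete after an exchange, so they bound
every decrease; the squares that result are bounded through the supremum of centered sums of
squares. The sign in `supCenteredSq` makes that supremum control the squares on the smaller of `S`
and its complement, whose mean is at most `(min u m) r`. -/
lemma upVar_supCentered_le (h0 : 0 ∈ K) {L r : ℝ}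
    (hn : Fintype.card α = m + u) (hu : 0 < u) (hL : ∀ h ∈ K, ∀ i, |h i| ≤ L)
    (hT : ∀ h ∈ K, ∑ i, h i ^ 2 ≤ (Fintype.card α : ℝ) * r) (S : Finset α) (hS : S.card = u) :
    2 * upVar Finset.univ (fun S => supCentered K (nonempty_of_mem h0) u S + supCenteredSq K (nonempty_of_mem h0) m u S) S ≤
      (16 + 4 * L ^ 2) * Fintype.card α *
        (supCentered K (nonempty_of_mem h0) u S + supCenteredSq K (nonempty_of_mem h0) m u S + (min u m : ℕ) * r) := by
  have hn' : (Fintype.card α : ℝ) = m + u := by rw [hn]; push_cast; rfl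
  have hnpos : (0 : ℝ) < Fintype.card α := by rw [hn]; exact_mod_cast (by omega : 0 < m + u)
  obtain ⟨g, hg, hgS⟩ := Finset.exists_mem_eq_sup' (nonempty_of_mem h0) (fun h : α → ℝ => centeredSum u h S)
  obtain ⟨w, hw, hwS⟩ := Finset.exists_mem_eq_sup' (nonempty_of_mem h0)
    (fun h : α → ℝ => (if u ≤ m then 1 else -1) * centeredSum u (h ^ 2) S)
  have hZ0 := supCentered_nonneg (u := u) h0 S
  have hW0 := supCenteredSq_nonneg (m := m) (u := u) h0 S
  set W := supCenteredSq K (nonempty_of_mem h0) m u S with hW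
  set Z := supCentered K (nonempty_of_mem h0) u S with hZ
  have hdiff : ∀ i ∈ S, ∀ j ∈ Finset.univ \ S,
      (Z + W) - (supCentered K (nonempty_of_mem h0) u (insert j (S.erase i)) +
        supCenteredSq K (nonempty_of_mem h0) m u (insert j (S.erase i))) ≤
      (g i - g j) + (if u ≤ m then 1 else -1) * (w i ^ 2 - w j ^ 2) := by
    intro i hi j hj
    have hj' := (Finset.mem_sdiff.1 hj).2
    have h1 := Finset.le_sup' (fun h : α → ℝ => centeredSum u h (insert j (S.erase i))) hg
    have h2 := Finset.le_sup' (fun h : α → ℝ => (if u ≤ m then 1 else -1) *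
      centeredSum u (h ^ 2) (insert j (S.erase i))) hw
    have h3 := centeredSum_sub_exchange u g hi hj'
    have h4 := centeredSum_sub_exchange u (w ^ 2) hi hj'
    have h5 : Z = centeredSum u g S := hgS
    have h6 : W = (if u ≤ m then 1 else -1) * centeredSum u (w ^ 2) S := hwS
    simp only [Pi.pow_apply] at h4
    rw [h5, h6, ← h3, ← h4, mul_sub]
    unfold supCentered supCenteredSq
    linarith
  have hsplit : ∀ h : α → ℝ, ∑ i, h i ^ 2 = ∑ i ∈ S, h i ^ 2 + ∑ i ∈ Finset.univ \ S, h i ^ 2 :=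
    fun h => by rw [add_comm, Finset.sum_sdiff (Finset.subset_univ S)]
  have hSnn : ∀ h : α → ℝ, 0 ≤ ∑ i ∈ S, h i ^ 2 := fun h =>
    Finset.sum_nonneg fun _ _ => sq_nonneg _
  have hCnn : ∀ h : α → ℝ, 0 ≤ ∑ i ∈ Finset.univ \ S, h i ^ 2 := fun h =>
    Finset.sum_nonneg fun _ _ => sq_nonneg _
  have hWle : ∀ h ∈ K, (if u ≤ m then 1 else -1) * centeredSum u (h ^ 2) S ≤ W := fun h hh =>
    Finset.le_sup' (fun h : α → ℝ => (if u ≤ m then 1 else -1) * centeredSum u (h ^ 2) S) hh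
  have hm0 : (0 : ℝ) ≤ m := Nat.cast_nonneg m
  have hu0 : (0 : ℝ) ≤ u := Nat.cast_nonneg u
  by_cases hum : u ≤ m
  · have hum' : (u : ℝ) ≤ m := by exact_mod_cast hum
    simp only [hum, if_true, one_mul, min_eq_left] at hdiff hWle ⊢
    have ha : ∀ h ∈ K, ∑ i ∈ S, h i ^ 2 ≤ W + u * r := by
      intro h hh
      have h1 := hWle h hh
      unfold centeredSum at h1
      simp only [Pi.pow_apply] at h1
      have h2 : (∑ i, h i ^ 2) / Fintype.card α ≤ r := by
        rw [div_le_iff₀ hnpos]; linarith [hT h hh]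
      have h3 := mul_le_mul_of_nonneg_left h2 hu0
      linarith
    have hV : upVar Finset.univ
        (fun S => supCentered K (nonempty_of_mem h0) u S + supCenteredSq K (nonempty_of_mem h0) m u S) S ≤
        ∑ i ∈ S, ∑ j ∈ Finset.univ \ S,
          ((4 * g i ^ 2 + 2 * L ^ 2 * w i ^ 2) + 4 * g j ^ 2) := by
      unfold upVar
      refine Finset.sum_le_sum fun i hi => Finset.sum_le_sum fun j hj => ?_
      refine (pow_le_pow_left₀ (le_max_right _ _)
        (max_le_max_right 0 (hdiff i hi j hj)) 2).trans ?_
      linarith [max_add_sq_le (g i - g j) (w i ^ 2 - w j ^ 2), max_sub_sq_le (g i) (g j),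
        max_sq_sub_sq_le (b := w j) (hL w hw i)]
    rw [sum_sum_compl_add S hS hn, Finset.sum_add_distrib, ← Finset.mul_sum, ← Finset.mul_sum,
      ← Finset.mul_sum] at hV
    have h1 := ha g hg
    have h2 := ha w hw
    have h3 := hT g hg
    rw [hsplit g] at h3
    -- The left side is `(m-u)` times the sum over `S` plus `u` times the full sum; only the sum
    -- over the smaller set `S` gets a weight of order `m`.
    have h4 : (m : ℝ) * ∑ i ∈ S, g i ^ 2 + u * ∑ i ∈ Finset.univ \ S, g i ^ 2 ≤
        Fintype.card α * (2 * (W + u * r)) := by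
      have e1 := mul_le_mul_of_nonneg_left h3 hu0
      have e2 : (m - u : ℝ) * ∑ i ∈ S, g i ^ 2 ≤ Fintype.card α * ∑ i ∈ S, g i ^ 2 :=
        mul_le_mul_of_nonneg_right (by rw [hn']; linarith) (hSnn g)
      have e3 := mul_le_mul_of_nonneg_left h1 hnpos.le
      have e4 := mul_nonneg hnpos.le hW0
      linarith
    have h5 : (m : ℝ) * ∑ i ∈ S, w i ^ 2 ≤ Fintype.card α * (W + u * r) :=
      (mul_le_mul_of_nonneg_right (by rw [hn']; linarith) (hSnn w)).trans
        (mul_le_mul_of_nonneg_left h2 hnpos.le)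
    have h6 := mul_le_mul_of_nonneg_left h5 (sq_nonneg L)
    have h7 := mul_nonneg (mul_nonneg (show (0 : ℝ) ≤ 16 + 4 * L ^ 2 by positivity) hnpos.le) hZ0
    linarith
  · have hum' : (m : ℝ) ≤ u := by exact_mod_cast (not_le.1 hum).le
    simp only [hum, if_false, min_eq_right (not_le.1 hum).le] at hdiff hWle ⊢
    -- Mirror case: the sign `-1` turns the centered sum over `S` into the one over the complement,
    -- now the smaller set.
    have hb : ∀ h ∈ K, ∑ i ∈ Finset.univ \ S, h i ^ 2 ≤ W + m * r := by
      intro h hh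
      have h1 := hWle h hh
      unfold centeredSum at h1
      simp only [Pi.pow_apply] at h1
      have h2 : (∑ i, h i ^ 2) / Fintype.card α ≤ r := by
        rw [div_le_iff₀ hnpos]; linarith [hT h hh]
      have h3 := mul_le_mul_of_nonneg_left h2 hm0
      have h4 : (m + u : ℝ) * ((∑ i, h i ^ 2) / Fintype.card α) = ∑ i, h i ^ 2 := by
        rw [← hn']; field_simp
      have h5 := hsplit h
      linarith
    have hV : upVar Finset.univ
        (fun S => supCentered K (nonempty_of_mem h0) u S + supCenteredSq K (nonempty_of_mem h0) m u S) S ≤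
        ∑ i ∈ S, ∑ j ∈ Finset.univ \ S,
          (4 * g i ^ 2 + (4 * g j ^ 2 + 2 * L ^ 2 * w j ^ 2)) := by
      unfold upVar
      refine Finset.sum_le_sum fun i hi => Finset.sum_le_sum fun j hj => ?_
      refine (pow_le_pow_left₀ (le_max_right _ _)
        (max_le_max_right 0 (hdiff i hi j hj)) 2).trans ?_
      have e := max_sq_sub_sq_le (b := w i) (hL w hw j)
      rw [show w j ^ 2 - w i ^ 2 = -1 * (w i ^ 2 - w j ^ 2) by ring] at e
      linarith [max_add_sq_le (g i - g j) (-1 * (w i ^ 2 - w j ^ 2)), max_sub_sq_le (g i) (g j)]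
    rw [sum_sum_compl_add S hS hn, Finset.sum_add_distrib, ← Finset.mul_sum, ← Finset.mul_sum,
      ← Finset.mul_sum] at hV
    have h1 := hb g hg
    have h2 := hb w hw
    have h3 := hT g hg
    rw [hsplit g] at h3
    have h4 : (m : ℝ) * ∑ i ∈ S, g i ^ 2 + u * ∑ i ∈ Finset.univ \ S, g i ^ 2 ≤
        Fintype.card α * (2 * (W + m * r)) := by
      have e1 := mul_le_mul_of_nonneg_left h3 hm0
      have e2 : (u - m : ℝ) * ∑ i ∈ Finset.univ \ S, g i ^ 2 ≤
          Fintype.card α * ∑ i ∈ Finset.univ \ S, g i ^ 2 :=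
        mul_le_mul_of_nonneg_right (by rw [hn']; linarith) (hCnn g)
      have e3 := mul_le_mul_of_nonneg_left h1 hnpos.le
      have e4 := mul_nonneg hnpos.le hW0
      linarith
    have h5 : (u : ℝ) * ∑ i ∈ Finset.univ \ S, w i ^ 2 ≤ Fintype.card α * (W + m * r) :=
      (mul_le_mul_of_nonneg_right (by rw [hn']; linarith) (hCnn w)).trans
        (mul_le_mul_of_nonneg_left h2 hnpos.le)
    have h6 := mul_le_mul_of_nonneg_left h5 (sq_nonneg L)
    have h7 := mul_nonneg (mul_nonneg (show (0 : ℝ) ≤ 16 + 4 * L ^ 2 by positivity) hnpos.le) hZ0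
    linarith

/-- The mean over the `u`-subsets of a finite type. -/
noncomputable def sliceMean (u : ℕ) (φ : Finset α → ℝ) : ℝ :=
  (∑ S ∈ (Finset.univ : Finset α).powersetCard u, φ S) / ((Fintype.card α).choose u : ℝ)

omit [DecidableEq α] in
lemma sliceMean_sq_le (u : ℕ) (φ : Finset α → ℝ) :
    sliceMean u φ ^ 2 ≤ sliceMean u (fun S => φ S ^ 2) := by
  unfold sliceMean
  have h := sq_sum_le_card_mul_sum_sq (s := (Finset.univ : Finset α).powersetCard u) (f := φ)
  rw [Finset.card_powersetCard, Finset.card_univ] at h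
  rcases Nat.eq_zero_or_pos ((Fintype.card α).choose u) with h0 | hpos
  · simp [h0]
  have hpos' : (0 : ℝ) < ((Fintype.card α).choose u : ℝ) := by exact_mod_cast hpos
  rw [div_pow, div_le_div_iff₀ (by positivity) hpos']
  nlinarith

/-- Talagrand-type inequality for sampling without replacement. -/
theorem card_filter_le_supCentered (h0 : 0 ∈ K) {L r : ℝ} (hr : 0 < r)
    (hn : Fintype.card α = m + u) (hm : 0 < m) (hu : 0 < u) (hL : ∀ h ∈ K, ∀ i, |h i| ≤ L)
    (hT : ∀ h ∈ K, ∑ i, h i ^ 2 ≤ (Fintype.card α : ℝ) * r) {ε x : ℝ} (hε : 0 < ε) (hε1 : ε ≤ 1)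
    (hx : 0 < x) :
    (((Finset.univ.powersetCard u).filter fun S =>
      2 * (sliceMean u (supCentered K (nonempty_of_mem h0) u) + sliceMean u (supCenteredSq K (nonempty_of_mem h0) m u)) +
        ε * ((min u m : ℕ) * r) + 8 * (16 + 4 * L ^ 2) * x / ε ≤
          supCentered K (nonempty_of_mem h0) u S).card : ℝ) ≤
      Real.exp (-x) * ((Fintype.card α).choose u : ℝ) := by
  set v := 16 + 4 * L ^ 2 with hv
  have hvpos : 0 < v := by positivity
  set c := (min u m : ℕ) * r with hc
  have hcpos : 0 < c := by
    have : 0 < min u m := lt_min hu hm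
    have : (0 : ℝ) < (min u m : ℕ) := by exact_mod_cast this
    positivity
  set G : Finset α → ℝ := fun S => supCentered K (nonempty_of_mem h0) u S + supCenteredSq K (nonempty_of_mem h0) m u S
    with hG
  have hG0 : ∀ S, 0 ≤ G S := fun S =>
    add_nonneg (supCentered_nonneg h0 S) (supCenteredSq_nonneg h0 S)
  -- Since the exchange variance of `G` is at most proportional to `G + c`, taking the square root,
  -- which divides it by `G + c`, leaves a constant.
  have hY : ∀ S ∈ (Finset.univ : Finset α).powersetCard u,
      2 * upVar Finset.univ (fun S => √(G S + c)) S ≤ v * (Finset.univ : Finset α).card := by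
    intro S hS
    have hSp : 0 < G S + c := by linarith [hG0 S]
    have h1 := upVar_supCentered_le h0 hn hu hL hT S (Finset.mem_powersetCard.1 hS).2
    have h2 : upVar Finset.univ (fun S => √(G S + c)) S ≤ upVar Finset.univ G S / (G S + c) := by
      unfold upVar
      rw [Finset.sum_div]
      refine Finset.sum_le_sum fun i _ => ?_
      rw [Finset.sum_div]
      refine Finset.sum_le_sum fun j _ => ?_
      have := max_sqrt_sub_sqrt_sq_le hSp (q := G (insert j (S.erase i)) + c)
        (by linarith [hG0 (insert j (S.erase i))])
      rwa [add_sub_add_right_eq_sub] at this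
    rw [le_div_iff₀ hSp] at h2
    rw [Finset.card_univ]
    refine le_of_mul_le_mul_right ?_ hSp
    calc 2 * upVar Finset.univ (fun S => √(G S + c)) S * (G S + c)
        ≤ 2 * upVar Finset.univ G S := by linarith
      _ ≤ v * Fintype.card α * (G S + c) := h1
  have hcard : u ≤ (Finset.univ : Finset α).card := by rw [Finset.card_univ]; omega
  have htail := card_filter_le_of_upVar_le Finset.univ u hu hcard _ hvpos hY hx
  rw [Finset.card_univ] at htail
  refine le_trans ?_ htail
  have hpos : (0 : ℝ) < ((Fintype.card α).choose u : ℝ) := by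
    exact_mod_cast Nat.choose_pos (by omega)
  have hmean : sliceMean u (fun S => √(G S + c)) ^ 2 ≤
      sliceMean u (supCentered K (nonempty_of_mem h0) u) + sliceMean u (supCenteredSq K (nonempty_of_mem h0) m u) + c := by
    refine (sliceMean_sq_le u _).trans (le_of_eq ?_)
    have e : ∀ S, √(G S + c) ^ 2 = G S + c := fun S => Real.sq_sqrt (by linarith [hG0 S])
    simp only [e, sliceMean]
    simp only [hG]
    rw [Finset.sum_add_distrib, Finset.sum_add_distrib, Finset.sum_const, Finset.card_powersetCard,
      Finset.card_univ, nsmul_eq_mul]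
    field_simp
  have hM0 : 0 ≤ sliceMean u (supCentered K (nonempty_of_mem h0) u) + sliceMean u (supCenteredSq K (nonempty_of_mem h0) m u) := by
    refine add_nonneg (div_nonneg (Finset.sum_nonneg fun S _ => supCentered_nonneg h0 S) hpos.le)
      (div_nonneg (Finset.sum_nonneg fun S _ => supCenteredSq_nonneg h0 S) hpos.le)
  refine Nat.cast_le.2 (Finset.card_le_card ?_)
  intro S hS
  rw [Finset.mem_filter] at hS ⊢
  refine ⟨hS.1, ?_⟩
  by_contra hlt
  rw [not_le] at hlt
  change √(G S + c) < sliceMean u (fun S => √(G S + c)) + 2 * √(v * x) at hlt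
  have h1 := pow_lt_pow_left₀ hlt (Real.sqrt_nonneg _) (two_ne_zero)
  rw [Real.sq_sqrt (by linarith [hG0 S])] at h1
  -- Keeping the factor `1 + ε` on the squared mean, instead of `2`, lets the shift `c` cancel up to
  -- `ε c`.
  have h2 := add_sq_le_of_pos (sliceMean u (fun S => √(G S + c))) (2 * √(v * x)) hε
  rw [mul_pow 2 (√(v * x)), Real.sq_sqrt (by positivity)] at h2
  have h3 : (1 + 1 / ε) * (2 ^ 2 * (v * x)) ≤ 8 * v * x / ε := by
    have : 1 ≤ 1 / ε := by rw [le_div_iff₀ hε]; linarith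
    have h4 := mul_le_mul_of_nonneg_right this (show 0 ≤ 4 * (v * x) by positivity)
    have : 8 * v * x / ε = 2 * (1 / ε * (4 * (v * x))) := by ring
    rw [this]; linarith
  have h4 := mul_le_mul_of_nonneg_left hmean (show 0 ≤ 1 + ε by linarith)
  have h5 := mul_le_mul_of_nonneg_right hε1 hM0
  have h6 : supCentered K (nonempty_of_mem h0) u S ≤ G S := by
    simp only [hG]; linarith [supCenteredSq_nonneg (m := m) (u := u) h0 S]
  linarith [hS.2]

end Centered


/-! ### The law of the test set -/

variable {m u : ℕ}

lemma permArray_succ (d : Draws m u) {k : ℕ} (hk : k < u) :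
    permArray d (k + 1) = permArray d k * Equiv.swap ⟨k, by omega⟩ (d ⟨k, hk⟩).1 := by
  simp [permArray, hk]

lemma permArray_succ_apply_self (d : Draws m u) (i : Fin u) :
    permArray d (i + 1) ⟨i, by omega⟩ = Z d i := by
  rw [permArray_succ d i.2]
  simp [Z]

/-- The first `i + 1` cells of the array do not change after step `i`. -/
lemma permArray_apply_of_lt (d : Draws m u) (i : Fin u) {k : ℕ} (hk : (i : ℕ) < k) :
    permArray d k ⟨i, by omega⟩ = Z d i := by
  induction k, hk using Nat.le_induction with
  | base => exact permArray_succ_apply_self d i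
  | succ k hk ih =>
    by_cases hku : k < u
    · have hk' : (i : ℕ) < k := hk
      rw [permArray_succ d hku, Equiv.Perm.mul_apply, Equiv.swap_apply_of_ne_of_ne, ih]
      · intro h
        have := congrArg Fin.val h
        simp at this; omega
      · intro h
        have := congrArg Fin.val h
        have h2 := (d ⟨k, hku⟩).2
        simp at this h2; omega
    · simp only [permArray, hku, dite_false]
      exact ih

lemma Z_injective (d : Draws m u) : Function.Injective (Z d) := by
  intro i j h
  rw [← permArray_apply_of_lt d i i.2, ← permArray_apply_of_lt d j j.2] at h
  have := congrArg Fin.val ((permArray d u).injective h)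
  exact Fin.ext (by simpa using this)

/-- The draws can be decoded step by step: earlier draws determine the current array, and that
array, being a permutation, reveals the position of the output. -/
lemma Z_inj_draws : Function.Injective (Z : Draws m u → Fin u → Fin (m + u)) := by
  intro d d' h
  have key : ∀ k ≤ u, permArray d k = permArray d' k ∧
      ∀ i : Fin u, (i : ℕ) < k → d i = d' i := by
    intro k
    induction k with
    | zero => intro _; exact ⟨rfl, fun i hi => absurd hi (Nat.not_lt_zero _)⟩
    | succ k ih =>
      intro hk
      obtain ⟨h1, h2⟩ := ih (by omega)
      have hku : k < u := hk
      have h3 : d ⟨k, hku⟩ = d' ⟨k, hku⟩ := by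
        have := congrFun h ⟨k, hku⟩
        simp only [Z, h1] at this
        exact Subtype.ext ((permArray d' k).injective this)
      refine ⟨by rw [permArray_succ d hku, permArray_succ d' hku, h1, h3], fun i hi => ?_⟩
      rcases Nat.lt_succ_iff_lt_or_eq.1 hi with hi | hi
      · exact h2 i hi
      · have : i = ⟨k, hku⟩ := Fin.ext hi
        rw [this, h3]
  exact funext fun i => (key u le_rfl).2 i i.2

lemma card_drawRange (i : Fin u) : Fintype.card (DrawRange m u i) = m + u - i := by
  rw [Fintype.card_subtype]
  have : (Finset.univ.filter fun j : Fin (m + u) => (i : ℕ) ≤ (j : ℕ)) =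
      Finset.Ici (⟨i, by omega⟩ : Fin (m + u)) := by
    ext j; simp [Fin.le_def]
  rw [this, Fin.card_Ici]

lemma card_draws : Fintype.card (Draws m u) = Fintype.card (Fin u ↪ Fin (m + u)) := by
  rw [Fintype.card_pi, Fintype.card_embedding_eq, Fintype.card_fin, Fintype.card_fin,
    Nat.descFactorial_eq_prod_range, ← Fin.prod_univ_eq_prod_range (fun i => m + u - i) u]
  exact Finset.prod_congr rfl fun i _ => card_drawRange i

/-- The output of RANDPERM as an injection. -/
def zEmb (d : Draws m u) : Fin u ↪ Fin (m + u) := ⟨Z d, Z_injective d⟩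

lemma zEmb_bijective : Function.Bijective (zEmb : Draws m u → (Fin u ↪ Fin (m + u))) := by
  rw [Fintype.bijective_iff_injective_and_card]
  exact ⟨fun d d' h => Z_inj_draws (congrArg DFunLike.coe h), card_draws⟩

lemma testSet_eq_map (d : Draws m u) : testSet d = Finset.univ.map (zEmb d) := by
  rw [Finset.map_eq_image]; rfl

/-- Symmetry of the sample: relabelling carries the injections onto one subset to those onto
another. -/
lemma exists_perm_map_eq {α : Type*} [Fintype α] [DecidableEq α] {S T : Finset α}
    (h : S.card = T.card) : ∃ σ : Equiv.Perm α, S.map σ.toEmbedding = T := by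
  obtain ⟨e⟩ : Nonempty (S ≃ T) := ⟨Finset.equivOfCardEq h⟩
  refine ⟨e.extendSubtype, Finset.eq_of_subset_of_card_le ?_ (by rw [Finset.card_map, h])⟩
  intro y hy
  obtain ⟨x, hx, rfl⟩ := Finset.mem_map.1 hy
  exact Equiv.extendSubtype_mem e x hx

/-- Every `u`-subset is the image of equally many injections. -/
lemma card_fiber_map_univ {α : Type*} [Fintype α] [DecidableEq α] {S T : Finset α}
    (h : S.card = T.card) :
    (Finset.univ.filter fun e : Fin u ↪ α => Finset.univ.map e = S).card =
      (Finset.univ.filter fun e : Fin u ↪ α => Finset.univ.map e = T).card := by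
  obtain ⟨σ, rfl⟩ := exists_perm_map_eq h
  refine Finset.card_bij' (fun e _ => e.trans σ.toEmbedding) (fun e _ => e.trans σ.symm.toEmbedding)
    ?_ ?_ ?_ ?_
  · intro e he
    simp only [Finset.mem_filter, Finset.mem_univ, true_and] at he ⊢
    rw [← Finset.map_map, he]
  · intro e he
    simp only [Finset.mem_filter, Finset.mem_univ, true_and] at he ⊢
    rw [← Finset.map_map, he, Finset.map_map]
    ext x; simp
  · intro e _; ext x; simp
  · intro e _; ext x; simp

lemma drawLaw_singleton (d : Draws m u) :
    (drawLaw m u).real {d} = 1 / (Fintype.card (Draws m u) : ℝ) := by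
  unfold drawLaw
  rw [measureReal_def, Measure.pi_singleton, ENNReal.toReal_prod, Fintype.card_pi]
  push_cast
  rw [one_div, ← Finset.prod_inv_distrib]
  refine Finset.prod_congr rfl fun i _ => ?_
  rw [PMF.toMeasure_apply_singleton _ _ (measurableSet_singleton _), PMF.uniformOfFintype_apply]
  simp

instance : IsProbabilityMeasure (drawLaw m u) := by
  unfold drawLaw; infer_instance

/-- The test set is a uniform `u`-subset of the sample. -/
theorem integral_testSet (φ : Finset (Fin (m + u)) → ℝ) :
    ∫ d, φ (testSet d) ∂(drawLaw m u) = sliceMean u φ := by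
  rw [integral_fintype (Integrable.of_finite)]
  simp only [drawLaw_singleton, smul_eq_mul]
  rw [← Finset.mul_sum]
  have key : ∃ c : ℕ, ∀ φ : Finset (Fin (m + u)) → ℝ,
      ∑ d : Draws m u, φ (testSet d) = c * ∑ S ∈ Finset.univ.powersetCard u, φ S := by
    obtain ⟨S₀, hS₀⟩ : ((Finset.univ : Finset (Fin (m + u))).powersetCard u).Nonempty :=
      Finset.powersetCard_nonempty.2 (by simp)
    refine ⟨(Finset.univ.filter fun e : Fin u ↪ Fin (m + u) => Finset.univ.map e = S₀).card,
      fun φ => ?_⟩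
    have h1 : ∑ d : Draws m u, φ (testSet d) =
        ∑ e : Fin u ↪ Fin (m + u), φ (Finset.univ.map e) := by
      simp only [testSet_eq_map]
      exact zEmb_bijective.sum_comp (fun e => φ (Finset.univ.map e))
    have h2 : ∀ e ∈ (Finset.univ : Finset (Fin u ↪ Fin (m + u))),
        Finset.univ.map e ∈ (Finset.univ : Finset (Fin (m + u))).powersetCard u := by
      intro e _; simp [Finset.mem_powersetCard]
    rw [h1, ← Finset.sum_fiberwise_of_maps_to h2, Finset.mul_sum]
    refine Finset.sum_congr rfl fun S hS => ?_
    rw [Finset.sum_congr rfl (fun e he => by rw [(Finset.mem_filter.1 he).2]), Finset.sum_const,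
      nsmul_eq_mul]
    congr 2
    exact card_fiber_map_univ (by
      rw [(Finset.mem_powersetCard.1 hS).2, (Finset.mem_powersetCard.1 hS₀).2])
  obtain ⟨c, hc⟩ := key
  -- The multiplicity `c` is identified by testing on the constant function.
  have h1 := hc fun _ => 1
  simp only [Finset.sum_const, Finset.card_univ, Finset.card_powersetCard, nsmul_eq_mul,
    mul_one] at h1
  have h2 : (Fintype.card (Draws m u) : ℝ) ≠ 0 := by
    exact_mod_cast Fintype.card_ne_zero
  rw [hc, sliceMean, h1]
  rw [h1] at h2
  have h3 := left_ne_zero_of_mul h2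
  have h4 := right_ne_zero_of_mul h2
  rw [Fintype.card_fin] at *
  field_simp

lemma drawLaw_real_testSet (P : Finset (Fin (m + u)) → Prop) [DecidablePred P] :
    (drawLaw m u).real {d | P (testSet d)} =
      (((Finset.univ.powersetCard u).filter P).card : ℝ) / ((m + u).choose u : ℝ) := by
  have h := integral_testSet (m := m) (u := u) (fun S => if P S then 1 else 0)
  rw [sliceMean, Finset.sum_boole, Fintype.card_fin] at h
  rw [← h, ← integral_indicator_one (Set.toFinite _).measurableSet]
  simp [Set.indicator_apply]


/-! ### Sub-root functions -/

/-- A positive value of `ψ` would create a positive fixed point, namely the supremum of `{s | s ≤ ψ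
s}`. Comparison with a multiple of `√` shows that this set is bounded and contains a positive point;
monotonicity replaces continuity at the supremum. -/
lemma IsSubRoot.eq_zero_of_fixedPoint_zero {ψ : ℝ → ℝ} (hψ : IsSubRoot ψ)
    (h0 : IsTheFixedPoint ψ 0) {r : ℝ} (hr : 0 < r) : ψ r ≤ 0 := by
  by_contra! hpos
  set q := ψ r / √r with hq
  have hqpos : 0 < q := div_pos hpos (Real.sqrt_pos.2 hr)
  have hlow : ∀ s, 0 < s → s ≤ r → q * √s ≤ ψ s := fun s hs hsr =>
    (le_div_iff₀ (Real.sqrt_pos.2 hs)).1 (hψ.anti hs hr hsr)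
  have hup : ∀ s, r ≤ s → ψ s ≤ q * √s := fun s hs =>
    (div_le_iff₀ (Real.sqrt_pos.2 (hr.trans_le hs))).1 (hψ.anti hr (hr.trans_le hs) hs)
  set A : Set ℝ := {s | 0 ≤ s ∧ s ≤ ψ s} with hA
  have hs₀ : 0 < min r (q ^ 2) := lt_min hr (by positivity)
  have hs₀A : min r (q ^ 2) ∈ A := by
    refine ⟨hs₀.le, le_trans ?_ (hlow _ hs₀ (min_le_left _ _))⟩
    have h1 : √(min r (q ^ 2)) ≤ q := by
      rw [Real.sqrt_le_left hqpos.le]; exact min_le_right _ _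
    have h2 := mul_le_mul_of_nonneg_right h1 (Real.sqrt_nonneg (min r (q ^ 2)))
    rwa [Real.mul_self_sqrt hs₀.le] at h2
  have hbdd : BddAbove A := by
    refine ⟨max r (q ^ 2), fun s hs => ?_⟩
    rcases le_total s r with h | h
    · exact h.trans (le_max_left _ _)
    · refine le_trans ?_ (le_max_right _ _)
      have hspos : 0 < s := hr.trans_le h
      have h1 := hs.2.trans (hup s h)
      nth_rw 1 [← Real.mul_self_sqrt hspos.le] at h1
      have h2 := le_of_mul_le_mul_right h1 (Real.sqrt_pos.2 hspos)
      exact (Real.sqrt_le_left hqpos.le).1 h2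
  have hle : min r (q ^ 2) ≤ sSup A := le_csSup hbdd hs₀A
  have hspos : 0 < sSup A := hs₀.trans_le hle
  have h1 : sSup A ≤ ψ (sSup A) := csSup_le ⟨_, hs₀A⟩ fun s hs =>
    hs.2.trans (hψ.mono hs.1 hspos.le (le_csSup hbdd hs))
  have h2 : ψ (sSup A) ≤ sSup A := by
    refine le_of_forall_gt_imp_ge_of_dense fun t ht => ?_
    have ht0 : 0 ≤ t := (hspos.trans ht).le
    have h3 : ψ t < t := by
      by_contra! h
      exact absurd (le_csSup hbdd (show t ∈ A from ⟨ht0, h⟩)) (not_le.2 ht)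
    exact (hψ.mono hspos.le ht0 ht.le).trans h3.le
  exact absurd (h0.2 ⟨hspos.le, le_antisymm h2 h1⟩) (not_le.2 hspos)

lemma IsSubRoot.le_sqrt_mul {ψ : ℝ → ℝ} (hψ : IsSubRoot ψ) {rs r : ℝ}
    (hrs : IsTheFixedPoint ψ rs) (hr : 0 < r) (hle : rs ≤ r) : ψ r ≤ √(r * rs) := by
  rcases hrs.1.1.eq_or_lt with h | h
  · rw [← h] at hrs
    exact (hψ.eq_zero_of_fixedPoint_zero hrs hr).trans (Real.sqrt_nonneg _)
  · have h1 : ψ r / √r ≤ ψ rs / √rs := hψ.anti h hr hle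
    rw [hrs.1.2, Real.div_sqrt, div_le_iff₀ (Real.sqrt_pos.2 hr)] at h1
    rwa [Real.sqrt_mul hr.le, mul_comm]

/-! ### Peeling -/

/-- The sample space is finite, so `g` is bounded and finitely many geometric shells suffice. -/
lemma measureReal_lt_le_sum {Ω : Type*} [MeasurableSpace Ω] [Finite Ω] (μ : Measure Ω)
    [IsProbabilityMeasure μ] (g : Ω → ℝ) (bad : ℝ → Set Ω) {r₀ : ℝ} (hr₀ : 0 < r₀)
    (hbad : ∀ ω r, 0 < r → r / 4 < g ω → g ω ≤ r → ω ∈ bad r) :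
    ∃ N : ℕ, μ.real {ω | r₀ < g ω} ≤
      ∑ j ∈ Finset.range N, μ.real (bad (r₀ * 4 ^ (j + 1))) := by
  obtain ⟨M, hM⟩ := (Set.finite_range g).bddAbove
  obtain ⟨N, hN⟩ := pow_unbounded_of_one_lt (M / r₀) (show (1 : ℝ) < 4 by norm_num)
  refine ⟨N, le_trans (measureReal_mono ?_ (measure_ne_top _ _))
    (measureReal_biUnion_finset_le _ _)⟩
  intro ω hω
  have hex : ∃ j, g ω ≤ r₀ * 4 ^ j := ⟨N, by
    rw [div_lt_iff₀ hr₀] at hN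
    linarith [hM ⟨ω, rfl⟩]⟩
  classical
  have hspec := Nat.find_spec hex
  rcases hj : Nat.find hex with _ | j
  · rw [hj] at hspec
    simp only [pow_zero, mul_one] at hspec
    exact absurd hspec (not_le.2 hω)
  rw [hj] at hspec
  have hmin := Nat.find_min hex (m := j) (by omega)
  have hjN : j < N := by
    have : Nat.find hex ≤ N := Nat.find_min' hex (by
      rw [div_lt_iff₀ hr₀] at hN
      linarith [hM ⟨ω, rfl⟩])
    omega
  refine Set.mem_iUnion₂.2 ⟨j, Finset.mem_range.2 hjN, hbad ω _ (by positivity) ?_ hspec⟩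
  rw [pow_succ]
  linarith [not_le.1 hmin]

lemma sum_half_pow_le (N : ℕ) : ∑ j ∈ Finset.range N, (1 / 2 : ℝ) ^ (j + 1) ≤ 1 := by
  have h : ∀ N : ℕ, ∑ j ∈ Finset.range N, (1 / 2 : ℝ) ^ (j + 1) = 1 - (1 / 2) ^ N := by
    intro N
    induction N with
    | zero => simp
    | succ N ih => rw [Finset.sum_range_succ, ih]; ring
  rw [h]
  have : (0 : ℝ) ≤ (1 / 2) ^ N := by positivity
  linarith

lemma exp_neg_one_le_half : Real.exp (-1) ≤ 1 / 2 := by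
  rw [Real.exp_neg, one_div]
  exact inv_anti₀ (by norm_num) (by linarith [Real.add_one_le_exp 1])

lemma exp_neg_mul_four_pow_le {x : ℝ} (hx : 1 ≤ x) (j : ℕ) :
    Real.exp (-(x * 4 ^ (j + 1))) ≤ Real.exp (-x) / 2 * (1 / 2) ^ (j + 1) := by
  have h1 : (j : ℝ) + 4 ≤ 4 ^ (j + 1) := by
    have : ∀ j : ℕ, j + 4 ≤ 4 ^ (j + 1) := by
      intro j
      induction j with
      | zero => norm_num
      | succ j ih => rw [pow_succ]; omega
    exact_mod_cast this j
  have h2 : -(x * 4 ^ (j + 1)) ≤ -x + -1 + ((j + 1 : ℕ) : ℝ) * (-1) := by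
    push_cast
    have := mul_le_mul hx h1 (by positivity) (by linarith)
    nlinarith
  refine (Real.exp_le_exp.2 h2).trans ?_
  rw [Real.exp_add, Real.exp_add, Real.exp_nat_mul, div_eq_mul_one_div (Real.exp (-x))]
  have := pow_le_pow_left₀ (Real.exp_pos (-1)).le exp_neg_one_le_half (j + 1)
  gcongr
  exact exp_neg_one_le_half

/-! ### The localized deviation bound -/

section Functionals

variable {α β : Type*} {m u : ℕ}

lemma centeredSum_le {ι : Type*} [Fintype ι] [Nonempty ι] (u : ℕ) {q : ι → ℝ} {L : ℝ}
    (hq : ∀ i, |q i| ≤ L) (T : Finset ι) : centeredSum u q T ≤ (T.card + u) * L := by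
  have hn : (0 : ℝ) < Fintype.card ι := by exact_mod_cast Fintype.card_pos
  have h1 : ∑ i ∈ T, q i ≤ T.card * L := by
    rw [← nsmul_eq_mul]
    exact Finset.sum_le_card_nsmul _ _ _ fun i _ => (abs_le.1 (hq i)).2
  have h2 : -L ≤ (∑ i, q i) / Fintype.card ι := by
    rw [le_div_iff₀ hn, mul_comm, ← Finset.card_univ, ← nsmul_eq_mul]
    exact Finset.card_nsmul_le_sum _ _ _ fun i _ => (abs_le.1 (hq i)).1
  have h3 := mul_le_mul_of_nonneg_left h2 (Nat.cast_nonneg (α := ℝ) u)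
  unfold centeredSum
  linarith

lemma mul_Rplus_u (hu : 0 < u) (S : Fin (m + u) → α × β) (d : Draws m u) (h : α × β → ℝ) :
    u * Rplus_u S d h = centeredSum u (fun i => h (S i)) (testSet d) := by
  have : (u : ℝ) ≠ 0 := by exact_mod_cast hu.ne'
  unfold Rplus_u testAvg fullAvg centeredSum
  rw [Fintype.card_fin]
  field_simp

/-- The training sum is the total minus the test sum, so training deviations are also centered sums
over the test set, with the opposite sign. -/
lemma mul_Rplus_m (hm : 0 < m) (S : Fin (m + u) → α × β) (d : Draws m u) (h : α × β → ℝ) :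
    m * Rplus_m S d h = -centeredSum u (fun i => h (S i)) (testSet d) := by
  have h1 : (m : ℝ) ≠ 0 := by exact_mod_cast hm.ne'
  have h2 : ((m + u : ℕ) : ℝ) ≠ 0 := by exact_mod_cast (by omega : m + u ≠ 0)
  have h3 := Finset.sum_add_sum_compl (testSet d) fun i => h (S i)
  unfold Rplus_m trainAvg fullAvg centeredSum trainSet
  rw [Fintype.card_fin, ← h3]
  field_simp
  push_cast
  ring

lemma mul_Rplus_min (hm : 0 < m) (hu : 0 < u) (S : Fin (m + u) → α × β) (d : Draws m u)
    (h : α × β → ℝ) : (min u m : ℕ) * Rplus_min S d h =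
      (if u ≤ m then 1 else -1) * centeredSum u (fun i => h (S i)) (testSet d) := by
  unfold Rplus_min
  by_cases hum : u ≤ m
  · simp only [hum, if_true, min_eq_left, one_mul]; exact mul_Rplus_u hu S d h
  · simp only [hum, if_false, min_eq_right (not_le.1 hum).le, mul_Rplus_m hm S d h]
    ring

lemma sliceMean_le_mul_expSup (Φ : Finset (Fin (m + u)) → ℝ) (c : ℝ)
    (R : Draws m u → (α × β → ℝ) → ℝ) (H : Set (α × β → ℝ))
    (h : ∀ d, Φ (testSet d) ≤ c * sSup (R d '' H)) : sliceMean u Φ ≤ c * expSup R H := by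
  rw [← integral_testSet, expSup, ← integral_const_mul]
  exact integral_mono Integrable.of_finite Integrable.of_finite h

/-- The bound `C` is essential: `sSup` of an unbounded real set is `0` and would dominate nothing.
-/
lemma le_mul_sSup_image {γ : Type*} (R : γ → ℝ) (H : Set γ) {c C : ℝ} (hc : 0 < c)
    (hC : ∀ h ∈ H, c * R h ≤ C) {h : γ} (hh : h ∈ H) : c * R h ≤ c * sSup (R '' H) := by
  refine mul_le_mul_of_nonneg_left (le_csSup ⟨C / c, ?_⟩ ⟨h, hh, rfl⟩) hc.le
  rintro _ ⟨g, hg, rfl⟩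
  rw [le_div_iff₀ hc, mul_comm]
  exact hC g hg

lemma drawLaw_real_lt_supCentered_le_exp {K : Finset (Fin (m + u) → ℝ)} (h0 : 0 ∈ K)
    {L r : ℝ} (hr : 0 < r) (hm : 0 < m) (hu : 0 < u) (hL : ∀ h ∈ K, ∀ i, |h i| ≤ L)
    (hT : ∀ h ∈ K, ∑ i, h i ^ 2 ≤ ((m + u : ℕ) : ℝ) * r) {c p ε y θ : ℝ}
    (hkc : ((min u m : ℕ) : ℝ) ≤ c)
    (h1 : sliceMean u (supCentered K (nonempty_of_mem h0) u) ≤ c * p)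
    (h2 : sliceMean u (supCenteredSq K (nonempty_of_mem h0) m u) ≤ c * p)
    (hε : 0 < ε) (hε1 : ε ≤ 1) (hy : 0 < y)
    (hθ : c * (4 * p) + c * (ε * r) + 8 * (16 + 4 * L ^ 2) * y / ε ≤ θ) :
    (drawLaw m u).real {d | θ < supCentered K (nonempty_of_mem h0) u (testSet d)} ≤
      Real.exp (-y) := by
  classical
  rw [drawLaw_real_testSet (fun S => θ < supCentered K (nonempty_of_mem h0) u S)]
  have hpos : (0 : ℝ) < ((m + u).choose u : ℝ) := by
    exact_mod_cast Nat.choose_pos (by omega)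
  rw [div_le_iff₀ hpos]
  have h := card_filter_le_supCentered h0 hr (Fintype.card_fin _) hm hu hL
    (by rwa [Fintype.card_fin]) hε hε1 hy
  rw [Fintype.card_fin] at h
  refine le_trans (Nat.cast_le.2 (Finset.card_le_card ?_)) h
  refine Finset.monotone_filter_right _ fun S _ hS => ?_
  have h3 : ((min u m : ℕ) : ℝ) * (ε * r) ≤ c * (ε * r) :=
    mul_le_mul_of_nonneg_right hkc (by positivity)
  have hS' : θ < supCentered K (nonempty_of_mem h0) u S := hS
  linarith

lemma drawLaw_real_lt_supCentered_le_markov {K : Finset (Fin (m + u) → ℝ)} (h0 : 0 ∈ K)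
    {θ : ℝ} (hθ : 0 < θ) :
    (drawLaw m u).real {d | θ < supCentered K (nonempty_of_mem h0) u (testSet d)} ≤
      sliceMean u (supCentered K (nonempty_of_mem h0) u) / θ := by
  rw [← integral_testSet, le_div_iff₀ hθ, mul_comm]
  refine le_trans (mul_le_mul_of_nonneg_left (measureReal_mono ?_) hθ.le)
    (mul_meas_ge_le_integral_of_nonneg (Filter.Eventually.of_forall fun d =>
      supCentered_nonneg h0 (testSet d)) Integrable.of_finite θ)
  exact fun d (hd : θ < _) => hd.le

/-- The localized excess risk bound for an estimator `g` whose excess risk is dominated by the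
deviation `R`. -/
theorem drawLaw_real_excess_le (hm : 0 < m) (hu : 0 < u) (S : Fin (m + u) → α × β)
    (ℓ : ℝ → β → ℝ) (F : Set (α → ℝ)) (fstar : α → ℝ) (hF : fstar ∈ F) {B L : ℝ} (hB : 0 < B)
    (hL : ∀ h ∈ deltaStar ℓ F fstar, ∀ i, |h (S i)| ≤ L)
    (hT : ∀ h ∈ deltaStar ℓ F fstar, fullSqAvg S h ≤ B * fullAvg S h)
    {ψ : ℝ → ℝ} {rs : ℝ} (hψ : IsSubRoot ψ) (hrs : IsTheFixedPoint ψ rs)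
    (R : Draws m u → (α × β → ℝ) → ℝ) {c σ : ℝ} (hc : 0 < c) (hkc : ((min u m : ℕ) : ℝ) ≤ c)
    (hσ : |σ| = 1)
    (hR : ∀ d h, c * R d h = centeredSum u (fun i => σ * h (S i)) (testSet d))
    (hψ₁ : ∀ r, rs ≤ r → expSup R (localDeltaStar S ℓ F fstar B r) ≤ ψ r)
    (hψ₂ : ∀ r, rs ≤ r → expSup (fun d h => Rplus_min S d (h ^ 2))
      (localDeltaStar S ℓ F fstar B r) ≤ ψ r)
    (g : Draws m u → (α × β → ℝ)) (hg : ∀ d, g d ∈ deltaStar ℓ F fstar)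
    (hgR : ∀ d, fullAvg S (g d) ≤ R d (g d))
    {κ ε : ℝ} (hε : 0 < ε) (hε1 : ε ≤ 1) (hεB : ε ≤ 1 / (12 * B)) (hκ1 : 1 ≤ κ)
    (hκB : 48 * B ≤ κ) (hκL : 96 * (16 + 4 * L ^ 2) * B / ε ≤ κ) {x : ℝ} (hx : 0 < x) :
    (drawLaw m u).real {d | κ ^ 2 * (rs + x / c) < B * fullAvg S (g d)} ≤ Real.exp (-x) / 2 := by
  classical
  have hrs0 : 0 ≤ rs := hrs.1.1
  have hκ : 0 < κ := by linarith
  have hnpos : (0 : ℝ) < ((m + u : ℕ) : ℝ) := by exact_mod_cast (by omega : 0 < m + u)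
  have : Nonempty (Fin (m + u)) := ⟨⟨0, by omega⟩⟩
  have hzero : (0 : α × β → ℝ) ∈ deltaStar ℓ F fstar := ⟨fstar, hF, by simp⟩
  -- The values of `g` are all that peeling needs, and there are finitely many. Adding `0` makes
  -- both suprema nonnegative.
  set H : ℝ → Finset (α × β → ℝ) := fun r =>
    (insert 0 (Finset.univ.image g)).filter fun h => B * fullAvg S h ≤ r with hH
  set K : ℝ → Finset (Fin (m + u) → ℝ) := fun r => (H r).image fun h i => σ * h (S i) with hK
  have hHmem : ∀ r, ∀ h ∈ H r, h ∈ localDeltaStar S ℓ F fstar B r := by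
    intro r h hh
    rw [hH, Finset.mem_filter, Finset.mem_insert, Finset.mem_image] at hh
    refine ⟨?_, hh.2⟩
    rcases hh.1 with rfl | ⟨d, -, rfl⟩
    · exact hzero
    · exact hg d
  have h0 : ∀ r, 0 < r → 0 ∈ K r := by
    intro r hr
    refine Finset.mem_image.2 ⟨0, Finset.mem_filter.2 ⟨Finset.mem_insert_self _ _, ?_⟩, ?_⟩
    · simpa [fullAvg] using hr.le
    · ext i; simp
  have hσ2 : σ ^ 2 = 1 := by rw [← sq_abs, hσ, one_pow]
  have hKL : ∀ r, ∀ q ∈ K r, ∀ i, |q i| ≤ L := by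
    intro r q hq i
    obtain ⟨h, hh, rfl⟩ := Finset.mem_image.1 hq
    rw [abs_mul, hσ, one_mul]
    exact hL h (hHmem r h hh).1 i
  have hKT : ∀ r, ∀ q ∈ K r, ∑ i, q i ^ 2 ≤ ((m + u : ℕ) : ℝ) * r := by
    intro r q hq
    obtain ⟨h, hh, rfl⟩ := Finset.mem_image.1 hq
    have h1 := (hT h (hHmem r h hh).1).trans (hHmem r h hh).2
    rw [fullSqAvg, one_div, ← div_eq_inv_mul, div_le_iff₀ hnpos] at h1
    simp only [mul_pow, hσ2, one_mul]
    linarith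
  have hmean₁ : ∀ r (hr : 0 < r), rs ≤ r →
      sliceMean u (supCentered (K r) (nonempty_of_mem (h0 r hr)) u) ≤ c * ψ r := by
    intro r hr hle
    refine (sliceMean_le_mul_expSup _ c R (localDeltaStar S ℓ F fstar B r) fun d => ?_).trans
      (mul_le_mul_of_nonneg_left (hψ₁ r hle) hc.le)
    refine Finset.sup'_le _ _ fun q hq => ?_
    obtain ⟨h, hh, rfl⟩ := Finset.mem_image.1 hq
    rw [← hR]
    refine le_mul_sSup_image (R d) _ (C := ((testSet d).card + u) * L) hc (fun h hh => ?_)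
      (hHmem r h hh)
    rw [hR]
    refine centeredSum_le u (fun i => ?_) _
    rw [abs_mul, hσ, one_mul]
    exact hL h hh.1 i
  have hψ0 : ∀ r, 0 < r → 0 ≤ ψ r := fun r hr => hψ.nonneg r hr.le
  have hmean₂ : ∀ r (hr : 0 < r), rs ≤ r →
      sliceMean u (supCenteredSq (K r) (nonempty_of_mem (h0 r hr)) m u) ≤ c * ψ r := by
    intro r hr hle
    have hk : (0 : ℝ) < (min u m : ℕ) := by exact_mod_cast lt_min hu hm
    refine (sliceMean_le_mul_expSup _ ((min u m : ℕ) : ℝ) (fun d h => Rplus_min S d (h ^ 2))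
      (localDeltaStar S ℓ F fstar B r) fun d => ?_).trans
      ((mul_le_mul_of_nonneg_left (hψ₂ r hle) hk.le).trans
        (mul_le_mul_of_nonneg_right hkc (hψ0 r hr)))
    refine Finset.sup'_le _ _ fun q hq => ?_
    obtain ⟨h, hh, rfl⟩ := Finset.mem_image.1 hq
    have e : ∀ h : α × β → ℝ, (fun i => σ * h (S i)) ^ 2 = fun i => (h ^ 2) (S i) := by
      intro h; ext i; simp [mul_pow, hσ2]
    rw [e, ← mul_Rplus_min hm hu]
    refine le_mul_sSup_image (fun h => Rplus_min S d (h ^ 2)) _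
      (C := ((testSet d).card + u) * L ^ 2) hk (fun h hh => ?_) (hHmem r h hh)
    have e2 : (if u ≤ m then (1 : ℝ) else -1) *
        centeredSum u (fun i => (h ^ 2) (S i)) (testSet d) =
        centeredSum u (fun i => (if u ≤ m then (1 : ℝ) else -1) * (h ^ 2) (S i)) (testSet d) := by
      unfold centeredSum
      rw [← Finset.mul_sum, ← Finset.mul_sum]; ring
    rw [mul_Rplus_min hm hu, e2]
    refine centeredSum_le u (fun i => ?_) _
    have e3 : |(if u ≤ m then (1 : ℝ) else -1)| = 1 := by split_ifs <;> simp
    rw [abs_mul, e3, one_mul, Pi.pow_apply, abs_pow]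
    exact pow_le_pow_left₀ (abs_nonneg _) (hL h hh.1 i) 2
  set r₀ := κ ^ 2 * (rs + x / c) with hr₀
  have hxc : 0 < x / c := div_pos hx hc
  have hr₀pos : 0 < r₀ := by positivity
  set bad : ℝ → Set (Draws m u) := fun r =>
    {d | ∀ hr : 0 < r, c * (r / (4 * B)) <
      supCentered (K r) (nonempty_of_mem (h0 r hr)) u (testSet d)} with hbad
  obtain ⟨N, hN⟩ := measureReal_lt_le_sum (drawLaw m u) (fun d => B * fullAvg S (g d)) bad hr₀pos
    (by
      intro d r hr h1 h2 hr'
      have hgK : (fun i => σ * g d (S i)) ∈ K r := Finset.mem_image.2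
        ⟨g d, Finset.mem_filter.2 ⟨Finset.mem_insert_of_mem
          (Finset.mem_image_of_mem g (Finset.mem_univ d)), h2⟩, rfl⟩
      refine lt_of_lt_of_le ?_ (Finset.le_sup' (fun h => centeredSum u h (testSet d)) hgK)
      rw [← hR]
      refine mul_lt_mul_of_pos_left (lt_of_lt_of_le ?_ (hgR d)) hc
      rw [div_lt_iff₀ (by positivity)]
      linarith)
  refine hN.trans ?_
  have hrj : ∀ j : ℕ, 0 < r₀ * 4 ^ (j + 1) := fun j => by positivity
  have hpow1 : ∀ j : ℕ, (1 : ℝ) ≤ 4 ^ (j + 1) := fun j => one_le_pow₀ (by norm_num)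
  have hκsq : 1 ≤ κ ^ 2 := one_le_pow₀ hκ1
  have hrsj : ∀ j : ℕ, rs * (κ * 2 ^ (j + 1)) ^ 2 ≤ r₀ * 4 ^ (j + 1) := by
    intro j
    have : (4 : ℝ) ^ (j + 1) = (2 ^ (j + 1)) ^ 2 := by
      rw [← pow_mul, mul_comm, pow_mul]; norm_num
    rw [hr₀, this]
    have h1 : rs ≤ rs + x / c := by linarith
    have h2 := mul_le_mul_of_nonneg_left h1
      (show (0 : ℝ) ≤ κ ^ 2 * (2 ^ (j + 1)) ^ 2 by positivity)
    linarith
  have hrsle : ∀ j : ℕ, rs ≤ r₀ * 4 ^ (j + 1) := by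
    intro j
    refine le_trans ?_ (hrsj j)
    refine le_mul_of_one_le_right hrs0 (one_le_pow₀ ?_)
    exact one_le_mul_of_one_le_of_one_le hκ1 (one_le_pow₀ (by norm_num))
  -- The extra `2^(j+1)`, due to the square-root growth of `ψ`, is what makes Markov's bounds
  -- summable over the shells.
  have hψj : ∀ j : ℕ, ψ (r₀ * 4 ^ (j + 1)) ≤ r₀ * 4 ^ (j + 1) / (κ * 2 ^ (j + 1)) := by
    intro j
    refine (hψ.le_sqrt_mul hrs (hrj j) (hrsle j)).trans ?_
    have hp : 0 < κ * (2 : ℝ) ^ (j + 1) := by positivity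
    rw [Real.sqrt_le_left (by have := hrj j; positivity), div_pow, le_div_iff₀ (by positivity)]
    have := mul_le_mul_of_nonneg_left (hrsj j) (hrj j).le
    linarith
  have hsplit : ∀ j : ℕ, (drawLaw m u).real (bad (r₀ * 4 ^ (j + 1))) ≤
      Real.exp (-x) / 2 * (1 / 2) ^ (j + 1) := by
    intro j
    have hsub : bad (r₀ * 4 ^ (j + 1)) ⊆ {d | c * (r₀ * 4 ^ (j + 1) / (4 * B)) <
        supCentered (K (r₀ * 4 ^ (j + 1))) (nonempty_of_mem (h0 _ (hrj j))) u (testSet d)} :=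
      fun d hd => hd (hrj j)
    refine (measureReal_mono hsub).trans ?_
    -- For small `x` the exponential tails need not sum to `e^(-x)/2`. Then `e^(-x)/2 ≥ 1/6`, and
    -- Markov's inequality is enough because `κ ≥ 48 B`.
    rcases le_total 1 x with hx1 | hx1
    · refine le_trans ?_ (exp_neg_mul_four_pow_le hx1 j)
      refine drawLaw_real_lt_supCentered_le_exp (h0 _ (hrj j)) (hrj j) hm hu (hKL _) (hKT _) hkc
        (hmean₁ _ (hrj j) (hrsle j)) (hmean₂ _ (hrj j) (hrsle j)) hε hε1 (by positivity) ?_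
      set r := r₀ * 4 ^ (j + 1) with hr
      have hrpos : 0 < r := hrj j
      -- The threshold `r/(4B)` is split into three parts `r/(12B)`: for the means, the variance
      -- term and the deviation term.
      have e1 : 4 * ψ r ≤ r / (12 * B) := by
        have h1 : r / (κ * 2 ^ (j + 1)) ≤ r / (48 * B) := by
          refine div_le_div_of_nonneg_left hrpos.le (by positivity) ?_
          exact hκB.trans (le_mul_of_one_le_right hκ.le (one_le_pow₀ (by norm_num)))
        have h2 := (hψj j).trans h1
        have h3 : 4 * (r / (48 * B)) = r / (12 * B) := by field_simp; norm_num
        linarith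
      have e2 : ε * r ≤ r / (12 * B) := by
        have := mul_le_mul_of_nonneg_right hεB hrpos.le
        rwa [one_div_mul_eq_div] at this
      have e3 : 8 * (16 + 4 * L ^ 2) * (x * 4 ^ (j + 1)) / ε ≤ c * (r / (12 * B)) := by
        have h1 : κ ≤ κ ^ 2 := by nlinarith
        have h2 : κ ^ 2 * x * 4 ^ (j + 1) ≤ c * r := by
          have : c * r = κ ^ 2 * (c * rs + x) * 4 ^ (j + 1) := by
            rw [hr, hr₀]; field_simp
          rw [this]
          have : x ≤ c * rs + x := by nlinarith [mul_nonneg hc.le hrs0]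
          gcongr
        have h3 := mul_le_mul_of_nonneg_right (hκL.trans h1)
          (show (0 : ℝ) ≤ x * 4 ^ (j + 1) by positivity)
        have h4 : c * (r / (12 * B)) = c * r / (12 * B) := by ring
        rw [h4, le_div_iff₀ (by positivity)]
        calc 8 * (16 + 4 * L ^ 2) * (x * 4 ^ (j + 1)) / ε * (12 * B)
            = 96 * (16 + 4 * L ^ 2) * B / ε * (x * 4 ^ (j + 1)) := by ring
          _ ≤ κ ^ 2 * (x * 4 ^ (j + 1)) := h3
          _ ≤ c * r := by linarith
      have e4 : c * (r / (4 * B)) = c * (r / (12 * B)) + c * (r / (12 * B)) +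
          c * (r / (12 * B)) := by field_simp; norm_num
      have e5 := mul_le_mul_of_nonneg_left e1 hc.le
      have e6 := mul_le_mul_of_nonneg_left e2 hc.le
      linarith
    · have hthr : 0 < c * (r₀ * 4 ^ (j + 1) / (4 * B)) := by have := hrj j; positivity
      refine (drawLaw_real_lt_supCentered_le_markov (h0 _ (hrj j)) hthr).trans ?_
      rw [div_le_iff₀ hthr]
      refine (hmean₁ _ (hrj j) (hrsle j)).trans ?_
      have h1 := mul_le_mul_of_nonneg_left (hψj j) hc.le
      refine h1.trans ?_
      set r := r₀ * 4 ^ (j + 1) with hr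
      have hrpos : 0 < r := hrj j
      have h2 : 1 / 6 ≤ Real.exp (-x) / 2 := by
        have h3 : Real.exp (-1) ≤ Real.exp (-x) := Real.exp_le_exp.2 (by linarith)
        have h4 : 1 / 3 ≤ Real.exp (-1) := by
          rw [Real.exp_neg, one_div]
          exact inv_anti₀ (Real.exp_pos 1) (by linarith [Real.exp_one_lt_d9])
        linarith
      have h5 : 4 * B / κ ≤ Real.exp (-x) / 2 := by
        refine le_trans ?_ h2
        rw [div_le_iff₀ hκ]; linarith
      have h6 : c * (r / (κ * 2 ^ (j + 1))) =
          4 * B / κ * ((1 / 2) ^ (j + 1) * (c * (r / (4 * B)))) := by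
        rw [one_div, inv_pow]; field_simp
      rw [h6, mul_assoc]
      exact mul_le_mul_of_nonneg_right h5 (by positivity)
  refine (Finset.sum_le_sum fun j _ => hsplit j).trans ?_
  rw [← Finset.mul_sum]
  exact mul_le_of_le_one_right (by positivity) (sum_half_pow_le N)

end Functionals


/-! ### Consequences of the Main Assumption -/

section Functionals

variable {α β : Type*} {m u : ℕ}

lemma fullAvg_sub (S : Fin (m + u) → α × β) (f g : α × β → ℝ) :
    fullAvg S (f - g) = fullAvg S f - fullAvg S g := by
  simp only [fullAvg, Pi.sub_apply, Finset.sum_sub_distrib, mul_sub]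

lemma testAvg_sub (S : Fin (m + u) → α × β) (d : Draws m u) (f g : α × β → ℝ) :
    testAvg S d (f - g) = testAvg S d f - testAvg S d g := by
  simp only [testAvg, Pi.sub_apply, Finset.sum_sub_distrib, mul_sub]

lemma trainAvg_sub (S : Fin (m + u) → α × β) (d : Draws m u) (f g : α × β → ℝ) :
    trainAvg S d (f - g) = trainAvg S d f - trainAvg S d g := by
  simp only [trainAvg, Pi.sub_apply, Finset.sum_sub_distrib, mul_sub]

lemma MainAssumption.fullAvg_nonneg {S : Fin (m + u) → α × β} {ℓ : ℝ → β → ℝ}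
    {F : Set (α → ℝ)} {fstar : α → ℝ} {B : ℝ} (hA : MainAssumption S ℓ F fstar B)
    {h : α × β → ℝ} (hh : h ∈ deltaStar ℓ F fstar) : 0 ≤ fullAvg S h := by
  obtain ⟨f, hf, rfl⟩ := hh
  rw [fullAvg_sub, sub_nonneg]
  exact hA.isMinOn hf

/-- For `B ≤ 0` the whole class vanishes on the sample. -/
lemma MainAssumption.fullAvg_eq_zero {S : Fin (m + u) → α × β} {ℓ : ℝ → β → ℝ}
    {F : Set (α → ℝ)} {fstar : α → ℝ} {B : ℝ} (hA : MainAssumption S ℓ F fstar B) (hB : B ≤ 0)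
    (hn : 0 < m + u) {h : α × β → ℝ} (hh : h ∈ deltaStar ℓ F fstar) : fullAvg S h = 0 := by
  have hnpos : (0 : ℝ) < ((m + u : ℕ) : ℝ) := by exact_mod_cast hn
  have h1 := (hA.sqAvg_le h hh).trans
    (mul_nonpos_of_nonpos_of_nonneg hB (hA.fullAvg_nonneg hh))
  rw [fullSqAvg, one_div, ← div_eq_inv_mul, div_le_iff₀ hnpos, zero_mul] at h1
  have h2 := (Finset.sum_eq_zero_iff_of_nonneg fun i _ => sq_nonneg (h (S i))).1
    (le_antisymm h1 (Finset.sum_nonneg fun i _ => sq_nonneg _))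
  have h3 : ∀ i, h (S i) = 0 := fun i => pow_eq_zero_iff two_ne_zero |>.1 (h2 i (Finset.mem_univ i))
  simp [fullAvg, h3]

end Functionals

end Transductive

theorem mainTheorem8 (B L₀ : ℝ) (hL₀ : 2 * √2 ≤ L₀) :
    ∃ c₂ : ℝ, 0 < c₂ ∧
      ∀ (m u : ℕ), 0 < m → 0 < u →
      ∀ (dim : ℕ) (X : Set (EuclideanSpace ℝ (Fin dim))) (Y : Set ℝ)
        (S : Fin (m + u) → X × Y) (ℓ : ℝ → Y → ℝ) (F : Set (X → ℝ)) (fstar : X → ℝ),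
      (∀ f ∈ F, ∀ i, 0 ≤ Transductive.lossFun ℓ f (S i) ∧
        Transductive.lossFun ℓ f (S i) ≤ L₀) →
      Transductive.MainAssumption S ℓ F fstar B →
      ∀ (ψ : ℝ → ℝ) (rstar : ℝ),
      Transductive.IsSubRoot ψ →
      Transductive.IsTheFixedPoint ψ rstar →
      (∀ r, rstar ≤ r →
        max (Transductive.expSup (Transductive.Rminus_u S)
              (Transductive.localDeltaStar S ℓ F fstar B r))
          (max (Transductive.expSup (Transductive.Rminus_m S)
                (Transductive.localDeltaStar S ℓ F fstar B r))
            (Transductive.expSup (fun d h => Transductive.Rplus_min S d (h ^ 2))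
              (Transductive.localDeltaStar S ℓ F fstar B r))) ≤ ψ r) →
      ∀ (fhat_u fhat_m : Transductive.Draws m u → (X → ℝ)),
      (∀ d, fhat_u d ∈ F ∧
        IsMinOn (fun f => Transductive.testAvg S d (Transductive.lossFun ℓ f)) F (fhat_u d)) →
      (∀ d, fhat_m d ∈ F ∧
        IsMinOn (fun f => Transductive.trainAvg S d (Transductive.lossFun ℓ f)) F (fhat_m d)) →
      ∀ x : ℝ, 0 < x →
        1 - Real.exp (-x) ≤ (Transductive.drawLaw m u).real
          {d | Transductive.fullAvg S
                (Transductive.lossFun ℓ (fhat_u d) - Transductive.lossFun ℓ fstar)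
                  ≤ c₂ * (rstar + x / u) ∧
               Transductive.fullAvg S
                (Transductive.lossFun ℓ (fhat_m d) - Transductive.lossFun ℓ fstar)
                  ≤ c₂ * (rstar + x / m)} := by
  -- For `B ≤ 0` both excess risks are zero; otherwise division by `B` is allowed.
  rcases le_or_gt B 0 with hB | hB
  · refine ⟨1, one_pos, ?_⟩
    intro m u hm hu dim X Y S ℓ F fstar _ hA ψ rs _ hrs _ gu gm hgu hgm x hx
    have hrs0 : 0 ≤ rs := hrs.1.1
    have hall : {d | Transductive.fullAvg S
        (Transductive.lossFun ℓ (gu d) - Transductive.lossFun ℓ fstar) ≤ 1 * (rs + x / u) ∧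
        Transductive.fullAvg S
        (Transductive.lossFun ℓ (gm d) - Transductive.lossFun ℓ fstar) ≤ 1 * (rs + x / m)} =
        Set.univ := by
      refine Set.eq_univ_of_forall fun d => ⟨?_, ?_⟩
      · rw [hA.fullAvg_eq_zero hB (by omega) ⟨_, (hgu d).1, rfl⟩]; positivity
      · rw [hA.fullAvg_eq_zero hB (by omega) ⟨_, (hgm d).1, rfl⟩]; positivity
    rw [hall, probReal_univ]
    linarith [Real.exp_pos (-x)]
  set ε := min 1 (1 / (12 * B)) with hε
  have hεpos : 0 < ε := lt_min one_pos (by positivity)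
  -- The sum of the three lower bounds that the localized estimate requires of `κ`; it depends on
  -- `B` and `L₀` only.
  set κ := 1 + 48 * B + 96 * (16 + 4 * L₀ ^ 2) * B / ε with hκ
  have hκ3 : 0 ≤ 96 * (16 + 4 * L₀ ^ 2) * B / ε := by positivity
  have hκpos : 0 < κ := by positivity
  refine ⟨κ ^ 2 / B, by positivity, ?_⟩
  intro m u hm hu dim X Y S ℓ F fstar hL hA ψ rs hψ hrs hbound gu gm hgu hgm x hx
  have hΔ : ∀ h ∈ Transductive.deltaStar ℓ F fstar, ∀ i, |h (S i)| ≤ L₀ := by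
    rintro _ ⟨f, hf, rfl⟩ i
    have h1 := hL f hf i
    have h2 := hL fstar hA.mem i
    rw [Pi.sub_apply, abs_le]
    constructor <;> linarith [h1.1, h1.2, h2.1, h2.2]
  have hu' : (0 : ℝ) < u := by exact_mod_cast hu
  have hm' : (0 : ℝ) < m := by exact_mod_cast hm
  have hU := Transductive.drawLaw_real_excess_le hm hu S ℓ F fstar hA.mem hB hΔ hA.sqAvg_le hψ hrs
    (Transductive.Rminus_u S) (c := u) (σ := -1) hu' (by exact_mod_cast min_le_left u m) (by simp)
    (fun d h => by
      rw [Transductive.Rminus_u, mul_neg, Transductive.mul_Rplus_u hu, Transductive.centeredSum,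
        Transductive.centeredSum, ← Finset.mul_sum, ← Finset.mul_sum]
      ring)
    (fun r hr => (le_max_left _ _).trans (hbound r hr))
    (fun r hr => ((le_max_right _ _).trans (le_max_right _ _)).trans (hbound r hr))
    (fun d => Transductive.lossFun ℓ (gu d) - Transductive.lossFun ℓ fstar)
    (fun d => ⟨_, (hgu d).1, rfl⟩)
    -- Comparing the minimizer with `fstar` on the test set makes the test average of the excess
    -- loss nonpositive.
    (fun d => by
      have h1 := (hgu d).2 hA.mem
      have h2 := Transductive.testAvg_sub S d (Transductive.lossFun ℓ (gu d))
        (Transductive.lossFun ℓ fstar)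
      simp only [Set.mem_ofPred_eq] at h1
      rw [Transductive.Rminus_u, Transductive.Rplus_u]
      linarith)
    hεpos (min_le_left _ _) (min_le_right _ _) (κ := κ) (by linarith) (by linarith)
    (by linarith) hx
  have hM := Transductive.drawLaw_real_excess_le hm hu S ℓ F fstar hA.mem hB hΔ hA.sqAvg_le hψ hrs
    (Transductive.Rminus_m S) (c := m) (σ := 1) hm' (by exact_mod_cast min_le_right u m) (by simp)
    (fun d h => by
      rw [Transductive.Rminus_m, mul_neg, Transductive.mul_Rplus_m hm, neg_neg]
      simp only [one_mul])
    (fun r hr => ((le_max_left _ _).trans (le_max_right _ _)).trans (hbound r hr))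
    (fun r hr => ((le_max_right _ _).trans (le_max_right _ _)).trans (hbound r hr))
    (fun d => Transductive.lossFun ℓ (gm d) - Transductive.lossFun ℓ fstar)
    (fun d => ⟨_, (hgm d).1, rfl⟩)
    (fun d => by
      have h1 := (hgm d).2 hA.mem
      have h2 := Transductive.trainAvg_sub S d (Transductive.lossFun ℓ (gm d))
        (Transductive.lossFun ℓ fstar)
      simp only [Set.mem_ofPred_eq] at h1
      rw [Transductive.Rminus_m, Transductive.Rplus_m]
      linarith)
    hεpos (min_le_left _ _) (min_le_right _ _) (κ := κ) (by linarith) (by linarith)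
    (by linarith) hx
  set G : Set (Transductive.Draws m u) := {d | Transductive.fullAvg S
      (Transductive.lossFun ℓ (gu d) - Transductive.lossFun ℓ fstar) ≤ κ ^ 2 / B * (rs + x / u) ∧
      Transductive.fullAvg S
      (Transductive.lossFun ℓ (gm d) - Transductive.lossFun ℓ fstar) ≤ κ ^ 2 / B * (rs + x / m)}
    with hG
  have hcover : Gᶜ ⊆ {d | κ ^ 2 * (rs + x / u) < B * Transductive.fullAvg S
        (Transductive.lossFun ℓ (gu d) - Transductive.lossFun ℓ fstar)} ∪
      {d | κ ^ 2 * (rs + x / m) < B * Transductive.fullAvg S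
        (Transductive.lossFun ℓ (gm d) - Transductive.lossFun ℓ fstar)} := by
    intro d hd
    by_contra hnot
    rw [Set.mem_union, not_or, Set.mem_ofPred_eq, Set.mem_ofPred_eq, not_lt, not_lt] at hnot
    refine hd ⟨?_, ?_⟩
    · rw [div_mul_eq_mul_div, le_div_iff₀ hB]; linarith [hnot.1]
    · rw [div_mul_eq_mul_div, le_div_iff₀ hB]; linarith [hnot.2]
  have h1 := (measureReal_mono hcover).trans
    (measureReal_union_le (μ := Transductive.drawLaw m u) _ _)
  rw [probReal_compl_eq_one_sub (Set.toFinite G).measurableSet] at h1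
  linarith
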